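/- Let $U\subset\mathbb R^2$ be a nonempty open set with coordinates $(x,y)$, and let $h,H:U\to\mathbb R$ be smooth positive functions satisfying $$\Delta\ln H=(\ln H)_{xx}+(\ln H)_{yy}=\tfrac12h^2-H^2\quad\text{on }U .$$ Put $\omega_\Sigma=h^2\,dx\wedge dy$, $l_2=-(\ln H)_y$, $n_2=(\ln H)_x$, and on $M=U\times\{(z,t)\in\mathbb R^2:0<z<\pi\}$ let $$\theta_3=\sin z\,dt-(\cos t\cos z\,H+\sin z\,l_2)\,dx-(-\sin t\cos z\,H+\sin z\,n_2)\,dy,$$ $$\theta_4=dz-\sin t\,H\,dx-\cos t\,H\,dy,\qquad g=\cos^2(z/2)\,h^2(dx^2+dy^2)+\theta_3^2+\theta_4^2 .$$ Then $g$ is a Riemannian metric on $M$, and the following hold, where the Kähler form of an orthogonal almost complex structure $I$ is $g(I\cdot,\cdot)$. (1) $(M,g)$ admits a Kähler structure $\bar J$ with Kähler form $\bar\Omega=\cos^2(z/2)\,\omega_\Sigma+\theta_4\wedge\theta_3$ and a Hermitian structure $J$ with Kähler form $\Omega=\cos^2(z/2)\,\omega_\Sigma+\theta_3\wedge\theta_4$;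 $J$ and $\bar J$ induce opposite orientations. (2) The Ricci tensor of $(M,g)$ is $J$-invariant. The Lee form $\theta$ of $(M,g,J)$, defined by $d\Omega=2\theta\wedge\Omega$, is $\theta=-\tan(z/2)\,\theta_4$, and $(M,g,J)$ is not locally conformally Kähler. (3) $(M,g,\bar J)$ is a QCH Kähler surface with respect to the distribution $\mathcal D=\mathrm{span}\{\partial_z,\partial_t\}$: $\mathcal D$ is $\bar J$-invariant, and for a unit vector $X\in T_pM$ the holomorphic curvature $R(X,\bar JX,\bar JX,X)$ depends only on $p$ and on the length of the orthogonal projection of $X$ onto $\mathcal D$. Moreover $J=-\bar J$ on $\mathcal D$ and $J=\bar J$ on $\mathcal D^\perp$. (4) The QCH surface $(M,g,\bar J)$ is not semi-symmetric, where a QCH surface is called semi-symmetric if $R(JX,JY,Z,W)=R(X,Y,Z,W)$ for the opposite structure $J$ (equivalently, if $\tau=\kappa$): at no point of $M$ does $R(JX,JY,Z,W)=R(X,Y,Z,W)$ hold for all $X,Y,Z,W$, and at no point is the scalar curvature $\tau$ equal to the conformal scalar curvature $\kappa=\tau-6(|\theta|^2+\delta\theta)$. Furthermore $R\cdot R=0$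 can hold at a point of $M$ only if the holomorphic sectional curvature of $(M,g,\bar J)$ is constant at that point. -/

import Mathlib

open scoped ContDiff Matrix

noncomputable section

namespace KSurf

/-! ## Tensor calculus on open subsets of `ℝ⁴`, in the standard global chart

A tensor field is given by its components with respect to the coordinate frame
`∂₀, ∂₁, ∂₂, ∂₃`. Only its values on the open set under consideration matter. -/

/-- Points of `ℝ⁴`, and also tangent vectors (components in the coordinate frame). -/
abbrev Pt := Fin 4 → ℝ

/-- Components of a one-form. -/
abbrev OneForm := Pt → Fin 4 → ℝ

/-- Components of a covariant 2-tensor (`T p i j = T(∂ᵢ,∂ⱼ)`), or of an endomorphism field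
(acting on vectors by `*ᵥ`). -/
abbrev Tens := Pt → Matrix (Fin 4) (Fin 4) ℝ

/-- The partial derivative `∂ᵢ f`. -/
def pd (i : Fin 4) (f : Pt → ℝ) (p : Pt) : ℝ := fderiv ℝ f p (Pi.single i 1)

/-- All components are smooth on `M`. -/
def IsSmoothOn (M : Set Pt) (T : Tens) : Prop :=
  ∀ i j, ContDiffOn ℝ ∞ (fun p => T p i j) M

/-- The value `T(X,Y)` of a covariant 2-tensor at a point. -/
def ev2 (T : Matrix (Fin 4) (Fin 4) ℝ) (X Y : Pt) : ℝ := ∑ i, ∑ j, T i j * X i * Y j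

/-- `g` is a Riemannian metric on `M`. -/
def IsRiemannian (M : Set Pt) (g : Tens) : Prop :=
  IsSmoothOn M g ∧ ∀ p ∈ M, (g p).PosDef

/-- The wedge product `a ∧ b` of two covectors, `(a ∧ b)(X,Y) = a(X) b(Y) - a(Y) b(X)`. -/
def wedge (a b : Fin 4 → ℝ) : Matrix (Fin 4) (Fin 4) ℝ :=
  Matrix.of fun i j => a i * b j - a j * b i

/-- The wedge product of a covector and a 2-form. -/
def wedge12 (a : Fin 4 → ℝ) (w : Matrix (Fin 4) (Fin 4) ℝ) (i j k : Fin 4) : ℝ :=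
  a i * w j k - a j * w i k + a k * w i j

/-- The exterior derivative of a 2-form. -/
def extD2 (w : Tens) (p : Pt) (i j k : Fin 4) : ℝ :=
  pd i (fun q => w q j k) p - pd j (fun q => w q i k) p + pd k (fun q => w q i j) p

/-- The Pfaffian of a 2-form: `w ∧ w = 2 pf(w) dx⁰ ∧ dx¹ ∧ dx² ∧ dx³`. -/
def pf (w : Matrix (Fin 4) (Fin 4) ℝ) : ℝ :=
  w 0 1 * w 2 3 - w 0 2 * w 1 3 + w 0 3 * w 1 2

/-! ### Levi-Civita connection and curvature -/

/-- Christoffel symbols: `∇_{∂ᵢ} ∂ⱼ = ∑ₖ Γᵏᵢⱼ ∂ₖ`. -/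
def christoffel (g : Tens) (k i j : Fin 4) (p : Pt) : ℝ :=
  (1 / 2) * ∑ l, (g p)⁻¹ k l *
    (pd i (fun q => g q j l) p + pd j (fun q => g q i l) p - pd l (fun q => g q i j) p)

/-- Curvature components: `R(∂ᵢ,∂ⱼ)∂ₖ = ∑ₗ (riem g l k i j) ∂ₗ`, for
`R(X,Y) = [∇_X,∇_Y] - ∇_{[X,Y]}`. -/
def riem (g : Tens) (l k i j : Fin 4) (p : Pt) : ℝ :=
  pd i (christoffel g l j k) p - pd j (christoffel g l i k) p
    + ∑ m, (christoffel g l i m p * christoffel g m j k p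
        - christoffel g l j m p * christoffel g m i k p)

/-- The vector `R(X,Y)Z`. -/
def curv (g : Tens) (p : Pt) (X Y Z : Pt) : Pt :=
  fun l => ∑ k, ∑ i, ∑ j, riem g l k i j p * X i * Y j * Z k

/-- `R(X,Y,Z,W) = g(R(X,Y)Z,W)`. -/
def curv4 (g : Tens) (p : Pt) (X Y Z W : Pt) : ℝ := ev2 (g p) (curv g p X Y Z) W

/-- The Ricci tensor `ρ(Y,Z) = tr (X ↦ R(X,Y)Z)`. -/
def ricci (g : Tens) : Tens := fun p => Matrix.of fun j k => ∑ i, riem g i k i j p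

/-- The scalar curvature `τ`. -/
def scal (g : Tens) (p : Pt) : ℝ := ∑ i, ∑ j, (g p)⁻¹ i j * ricci g p i j

/-- The codifferential `δa = - tr_g ∇a` of a one-form. -/
def codiff (g : Tens) (a : OneForm) (p : Pt) : ℝ :=
  - ∑ i, ∑ j, (g p)⁻¹ i j *
    (pd i (fun q => a q j) p - ∑ k, christoffel g k i j p * a p k)

/-- The squared norm `|a|²` of a one-form. -/
def normSq (g : Tens) (a : OneForm) (p : Pt) : ℝ := ∑ i, ∑ j, (g p)⁻¹ i j * a p i * a p j

/-- The conformal scalar curvature `κ = τ - 6(|θ|² + δθ)` of a Hermitian surface with Lee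
form `θ`. -/
def confScal (g : Tens) (lee : OneForm) (p : Pt) : ℝ :=
  scal g p - 6 * (normSq g lee p + codiff g lee p)

/-! ### Hermitian and Kähler structures -/

/-- The Kähler form `Ω(X,Y) = g(JX,Y)`. -/
def kahlerForm (g J : Tens) : Tens := fun p => (J p)ᵀ * g p

/-- The Nijenhuis tensor, component along `∂ₖ` of `N(∂ᵢ,∂ⱼ)`. -/
def nijenhuis (J : Tens) (k i j : Fin 4) (p : Pt) : ℝ :=
  ∑ l, (J p l i * pd l (fun q => J q k j) p - J p l j * pd l (fun q => J q k i) p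
    - J p k l * (pd i (fun q => J q l j) p - pd j (fun q => J q l i) p))

/-- `(M,g,J)` is a Hermitian surface: `g` is a Riemannian metric and `J` is a smooth orthogonal
integrable almost complex structure. -/
structure IsHermitian (M : Set Pt) (g J : Tens) : Prop where
  riemannian : IsRiemannian M g
  smooth : IsSmoothOn M J
  sq : ∀ p ∈ M, J p * J p = -1
  orthogonal : ∀ p ∈ M, ∀ X Y : Pt, ev2 (g p) (J p *ᵥ X) (J p *ᵥ Y) = ev2 (g p) X Y
  integrable : ∀ p ∈ M, ∀ i j k, nijenhuis J k i j p = 0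

/-- `(M,g,J)` is a Kähler surface: it is Hermitian with closed Kähler form. -/
structure IsKahler (M : Set Pt) (g J : Tens) : Prop where
  hermitian : IsHermitian M g J
  closed : ∀ p ∈ M, ∀ i j k, extD2 (kahlerForm g J) p i j k = 0

/-- `a` is the Lee form of `(M,g,J)`: `dΩ = 2 a ∧ Ω`. -/
def IsLeeForm (M : Set Pt) (g J : Tens) (a : OneForm) : Prop :=
  ∀ p ∈ M, ∀ i j k,
    extD2 (kahlerForm g J) p i j k = 2 * wedge12 (a p) (kahlerForm g J p) i j k

/-- `(M,g,J)` is locally conformally Kähler: near every point some conformal metric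
`e^{2u} g` is Kähler with respect to `J`. -/
def IsLCK (M : Set Pt) (g J : Tens) : Prop :=
  ∀ p ∈ M, ∃ V : Set Pt, IsOpen V ∧ p ∈ V ∧ V ⊆ M ∧ ∃ u : Pt → ℝ, ContDiffOn ℝ ∞ u V ∧
    IsKahler V (fun q => Real.exp (2 * u q) • g q) J

/-- The two orthogonal almost complex structures induce opposite orientations. -/
def AreOpposite (M : Set Pt) (g J Jbar : Tens) : Prop :=
  ∀ p ∈ M, pf (kahlerForm g J p) * pf (kahlerForm g Jbar p) < 0

/-- The Ricci tensor is `J`-invariant. -/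
def RicciInvariant (M : Set Pt) (g J : Tens) : Prop :=
  ∀ p ∈ M, ∀ X Y : Pt, ev2 (ricci g p) (J p *ᵥ X) (J p *ᵥ Y) = ev2 (ricci g p) X Y

/-! ### QCH surfaces and semi-symmetry -/

/-- `X` is `g`-orthogonal to the plane `D`. -/
def Perp (g : Matrix (Fin 4) (Fin 4) ℝ) (D : Submodule ℝ Pt) (X : Pt) : Prop :=
  ∀ Y ∈ D, ev2 g X Y = 0

/-- A smooth distribution of rank two on `M`. -/
def IsPlaneField (M : Set Pt) (D : Pt → Submodule ℝ Pt) : Prop :=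
  ∀ p ∈ M, ∃ V : Set Pt, IsOpen V ∧ p ∈ V ∧ V ⊆ M ∧ ∃ v w : Pt → Pt,
    ContDiffOn ℝ ∞ v V ∧ ContDiffOn ℝ ∞ w V ∧
    ∀ q ∈ V, LinearIndependent ℝ ![v q, w q] ∧ D q = Submodule.span ℝ {v q, w q}

/-- The holomorphic curvature `R(X,JX,JX,X)` (for a unit vector `X`). -/
def holCurv (g J : Tens) (p : Pt) (X : Pt) : ℝ :=
  curv4 g p X (J p *ᵥ X) (J p *ᵥ X) X

/-- `(M,g,J)` is a QCH Kähler surface with respect to the `J`-invariant plane field `D`: the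
holomorphic curvature of the plane spanned by `X, JX`, for a unit vector `X` at `p`, depends only
on `p` and on the length of the orthogonal projection of `X` onto `D`. Below `X = A + B` and
`X' = A' + B'` are the orthogonal decompositions of the two unit vectors. -/
structure IsQCH (M : Set Pt) (g J : Tens) (D : Pt → Submodule ℝ Pt) : Prop where
  kahler : IsKahler M g J
  planeField : IsPlaneField M D
  invariant : ∀ p ∈ M, ∀ X ∈ D p, J p *ᵥ X ∈ D p
  quasiConst : ∀ p ∈ M, ∀ A ∈ D p, ∀ A' ∈ D p, ∀ B B' : Pt,
    Perp (g p) (D p) B → Perp (g p) (D p) B' →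
    ev2 (g p) (A + B) (A + B) = 1 → ev2 (g p) (A' + B') (A' + B') = 1 →
    ev2 (g p) A A = ev2 (g p) A' A' →
    holCurv g J p (A + B) = holCurv g J p (A' + B')

/-- `J` is the natural opposite structure of `(Jbar, D)`: `J = -Jbar` on `D` and `J = Jbar` on
the orthogonal complement of `D`. -/
def IsNaturalOpposite (M : Set Pt) (g J Jbar : Tens) (D : Pt → Submodule ℝ Pt) : Prop :=
  ∀ p ∈ M, (∀ X ∈ D p, J p *ᵥ X = -(Jbar p *ᵥ X)) ∧
    ∀ X : Pt, Perp (g p) (D p) X → J p *ᵥ X = Jbar p *ᵥ X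

/-- The first Gray condition `R(JX,JY,Z,W) = R(X,Y,Z,W)` at the point `p`. A QCH Kähler surface is
semi-symmetric when its natural opposite structure `J` satisfies this condition everywhere. -/
def GrayG1At (g J : Tens) (p : Pt) : Prop :=
  ∀ X Y Z W : Pt, curv4 g p (J p *ᵥ X) (J p *ᵥ Y) Z W = curv4 g p X Y Z W

/-- `R . R = 0` at the point `p`, where `R(X,Y)` acts on `R` as a derivation. -/
def DerivedCurvZeroAt (g : Tens) (p : Pt) : Prop :=
  ∀ X Y Z W V : Pt,
    curv g p X Y (curv g p Z W V) - curv g p (curv g p X Y Z) W V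
      - curv g p Z (curv g p X Y W) V - curv g p Z W (curv g p X Y V) = 0

/-- The holomorphic sectional curvature is constant at the point `p`. -/
def ConstHolCurvAt (g J : Tens) (p : Pt) : Prop :=
  ∃ c : ℝ, ∀ X : Pt, ev2 (g p) X X = 1 → holCurv g J p X = c

/-! ## The explicit metric

The coordinates are `p 0 = x`, `p 1 = y`, `p 2 = z`, `p 3 = t`. -/

/-- `∂f/∂x` for a function of `(x,y)`. -/
def dX (f : ℝ × ℝ → ℝ) (q : ℝ × ℝ) : ℝ := fderiv ℝ f q (1, 0)

/-- `∂f/∂y` for a function of `(x,y)`. -/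
def dY (f : ℝ × ℝ → ℝ) (q : ℝ × ℝ) : ℝ := fderiv ℝ f q (0, 1)

/-- The function `ln H`. -/
def logF (H : ℝ × ℝ → ℝ) (q : ℝ × ℝ) : ℝ := Real.log (H q)

/-- The Euclidean Laplacian `f_xx + f_yy`. -/
def lap (f : ℝ × ℝ → ℝ) (q : ℝ × ℝ) : ℝ := dX (dX f) q + dY (dY f) q

/-- The point `(x,y)` below `p`. -/
def base (p : Pt) : ℝ × ℝ := (p 0, p 1)

/-- `M = U × {(z,t) : 0 < z < π}`. -/
def dom (U : Set (ℝ × ℝ)) : Set Pt := {p | base p ∈ U ∧ 0 < p 2 ∧ p 2 < Real.pi}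

/-- `θ₃ = sin z dt - (cos t cos z H + sin z l₂) dx - (-sin t cos z H + sin z n₂) dy`
with `l₂ = -(ln H)_y`, `n₂ = (ln H)_x`. -/
def theta3 (H : ℝ × ℝ → ℝ) : OneForm := fun p =>
  ![-(Real.cos (p 3) * Real.cos (p 2) * H (base p)
        + Real.sin (p 2) * (-(dY (logF H) (base p)))),
    -(-(Real.sin (p 3)) * Real.cos (p 2) * H (base p)
        + Real.sin (p 2) * dX (logF H) (base p)),
    0,
    Real.sin (p 2)]

/-- `θ₄ = dz - sin t H dx - cos t H dy`. -/
def theta4 (H : ℝ × ℝ → ℝ) : OneForm := fun p =>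
  ![-(Real.sin (p 3) * H (base p)), -(Real.cos (p 3) * H (base p)), 1, 0]

/-- The coordinate covector `dxⁱ`. -/
def dcoord (i : Fin 4) : Fin 4 → ℝ := Pi.single i 1

/-- `g = cos²(z/2) h² (dx² + dy²) + θ₃² + θ₄²`. -/
def metric (h H : ℝ × ℝ → ℝ) : Tens := fun p => Matrix.of fun i j =>
  Real.cos (p 2 / 2) ^ 2 * h (base p) ^ 2
      * (dcoord 0 i * dcoord 0 j + dcoord 1 i * dcoord 1 j)
    + theta3 H p i * theta3 H p j + theta4 H p i * theta4 H p j

/-- The form `cos²(z/2) ω_Σ`, where `ω_Σ = h² dx ∧ dy`. -/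
def baseForm (h : ℝ × ℝ → ℝ) : Tens := fun p =>
  (Real.cos (p 2 / 2) ^ 2 * h (base p) ^ 2) • wedge (dcoord 0) (dcoord 1)

/-- The form `-tan(z/2) θ₄`. -/
def leeForm (H : ℝ × ℝ → ℝ) : OneForm := fun p => fun i =>
  -(Real.tan (p 2 / 2)) * theta4 H p i

/-- The distribution spanned by `∂_z` and `∂_t`. -/
def vertical : Pt → Submodule ℝ Pt := fun _ =>
  Submodule.span ℝ {Pi.single 2 1, Pi.single 3 1}

end KSurf

end

/-! Everything is read off from Cartan's structure equations in the orthonormal coframe `cos(z/2) h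
dx`, `cos(z/2) h dy`, `θ₃`, `θ₄`. Put `α = H(sin t dx + cos t dy)`, `β = H(cos t dx - sin t dy)` and
`τ = dt - ⋆d ln H`. Then `dα = τ ∧ β` and `dβ = -τ ∧ α`, and the equation for `Δ ln H` says
precisely that `dτ = -α ∧ β - ½ h² dx ∧ dy`. Thus `α, β, τ` form an `so(3)`-connection over `U`
whose only curvature is the `h²` term. The forms `θ₄ = dz - α` and `θ₃ = sin z τ - cos z β` are the
covariant versions of `dz` and `sin z dt`, so the fibres are pieces of the round unit sphere.

Consequently the Levi-Civita connection matrix `connMat` is explicit (`structure_eq`), and its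
curvature (`curvForm_eq`) is that of constant holomorphic curvature `1`, corrected by a multiple `A
- 1` of the square of the base two-form. A single function `A = baseCurv` therefore governs all
pointwise statements.

The connection matrix commutes with `frameKahler`, so `J̄` is parallel. Its commutator with
`frameHerm` is `tan(z/2)` times a constant tensor supported on the base directions; this gives
integrability of `J` and the Lee form. The Lee form is not closed (`extD1_leeForm`), which excludes
a local conformal Kähler metric. The holomorphic curvature of a unit vector is `1 + (A - 1) r⁴`,
with `r` the length of its horizontal part, hence QCH. Finally `|θ|² + δθ = 1`, so `κ = τ - 6`, with
`τ` here the scalar curvature. One component of the curvature, independent of `A`, violates the Gray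
condition, and one component of `R·R` equals `(1 - A)/4`. -/

noncomputable section

namespace KSurf

/-! ## Moving frames -/

/-- Componentwise partial derivative of a matrix-valued function. -/
def pdMat (i : Fin 4) (T : Tens) (p : Pt) : Matrix (Fin 4) (Fin 4) ℝ :=
  Matrix.of fun a b => pd i (fun q => T q a b) p

/-- All components are differentiable at `p`. -/
def DiffTens (T : Tens) (p : Pt) : Prop := ∀ a b, DifferentiableAt ℝ (fun q => T q a b) p

theorem pd_mul {f g : Pt → ℝ} {p : Pt} (hf : DifferentiableAt ℝ f p)
    (hg : DifferentiableAt ℝ g p) (i : Fin 4) :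
    pd i (fun q => f q * g q) p = pd i f p * g p + f p * pd i g p := by
  simp only [pd]
  rw [fderiv_fun_mul hf hg]
  simp
  ring

theorem pd_add {f g : Pt → ℝ} {p : Pt} (hf : DifferentiableAt ℝ f p)
    (hg : DifferentiableAt ℝ g p) (i : Fin 4) :
    pd i (fun q => f q + g q) p = pd i f p + pd i g p := by
  simp only [pd]
  rw [fderiv_fun_add hf hg]
  simp

theorem pd_sum {ι : Type*} (s : Finset ι) {f : ι → Pt → ℝ} {p : Pt}
    (hf : ∀ a ∈ s, DifferentiableAt ℝ (f a) p) (i : Fin 4) :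
    pd i (fun q => ∑ a ∈ s, f a q) p = ∑ a ∈ s, pd i (f a) p := by
  simp only [pd]
  rw [fderiv_fun_sum hf]
  simp

theorem pd_const (c : ℝ) (i : Fin 4) (p : Pt) : pd i (fun _ => c) p = 0 := by
  simp [pd]

theorem pd_congr {f g : Pt → ℝ} {M : Set Pt} (hM : IsOpen M) {p : Pt} (hp : p ∈ M)
    (h : ∀ q ∈ M, f q = g q) (i : Fin 4) : pd i f p = pd i g p := by
  simp only [pd]
  rw [Filter.EventuallyEq.fderiv_eq (Filter.eventuallyEq_of_mem (hM.mem_nhds hp) h)]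

theorem DiffTens.mul {S T : Tens} {p : Pt} (hS : DiffTens S p) (hT : DiffTens T p) :
    DiffTens (fun q => S q * T q) p := fun a b => by
  simp only [Matrix.mul_apply]
  exact DifferentiableAt.fun_sum fun c _ => (hS a c).mul (hT c b)

theorem DiffTens.transpose {T : Tens} {p : Pt} (hT : DiffTens T p) :
    DiffTens (fun q => (T q)ᵀ) p := fun a b => hT b a

theorem DiffTens.const (K : Matrix (Fin 4) (Fin 4) ℝ) (p : Pt) : DiffTens (fun _ => K) p :=
  fun _ _ => differentiableAt_const _

theorem pdMat_mul {S T : Tens} {p : Pt} (hS : DiffTens S p) (hT : DiffTens T p) (i : Fin 4) :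
    pdMat i (fun q => S q * T q) p = pdMat i S p * T p + S p * pdMat i T p := by
  ext a b
  simp only [pdMat, Matrix.of_apply, Matrix.mul_apply, Matrix.add_apply]
  rw [pd_sum _ (f := fun c q => S q a c * T q c b) (fun c _ => (hS a c).mul (hT c b)),
    ← Finset.sum_add_distrib]
  exact Finset.sum_congr rfl fun c _ => pd_mul (hS a c) (hT c b) i

theorem pdMat_add {S T : Tens} {p : Pt} (hS : DiffTens S p) (hT : DiffTens T p) (i : Fin 4) :
    pdMat i (fun q => S q + T q) p = pdMat i S p + pdMat i T p := by
  ext a b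
  exact pd_add (hS a b) (hT a b) i

theorem pdMat_const (K : Matrix (Fin 4) (Fin 4) ℝ) (i : Fin 4) (p : Pt) :
    pdMat i (fun _ => K) p = 0 := by
  ext a b
  exact pd_const _ i p

theorem pdMat_congr {S T : Tens} {M : Set Pt} (hM : IsOpen M) {p : Pt} (hp : p ∈ M)
    (h : ∀ q ∈ M, S q = T q) (i : Fin 4) : pdMat i S p = pdMat i T p := by
  ext a b
  exact pd_congr hM hp (fun q hq => by rw [h q hq]) i

theorem pdMat_transpose (T : Tens) (i : Fin 4) (p : Pt) :
    pdMat i (fun q => (T q)ᵀ) p = (pdMat i T p)ᵀ := rfl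

theorem pd_eq_comp (i : Fin 4) (f : Pt → ℝ) :
    pd i f = fun q => fderiv ℝ f q (Pi.single i 1) := rfl

theorem contDiffOn_pd {f : Pt → ℝ} {M : Set Pt} (hM : IsOpen M) (hf : ContDiffOn ℝ ∞ f M)
    (i : Fin 4) : ContDiffOn ℝ ∞ (pd i f) M :=
  (hf.fderiv_of_isOpen hM (by simp)).clm_apply contDiffOn_const

theorem pd_comm {f : Pt → ℝ} {M : Set Pt} (hM : IsOpen M) (hf : ContDiffOn ℝ ∞ f M) {p : Pt}
    (hp : p ∈ M) (i j : Fin 4) : pd i (pd j f) p = pd j (pd i f) p := by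
  have hd : DifferentiableAt ℝ (fderiv ℝ f) p :=
    ((hf.fderiv_of_isOpen hM (m := ∞) (by simp)).contDiffAt (hM.mem_nhds hp)).differentiableAt
      (by simp)
  have hs : IsSymmSndFDerivAt ℝ f p :=
    (hf.contDiffAt (hM.mem_nhds hp)).isSymmSndFDerivAt (by
      rw [minSmoothness_of_isRCLikeNormedField]; exact WithTop.coe_le_coe.2 (le_top : (2 : ℕ∞) ≤ ⊤))
  have key : ∀ k l : Fin 4, pd k (pd l f) p
      = fderiv ℝ (fderiv ℝ f) p (Pi.single k 1) (Pi.single l 1) := fun k l => by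
    rw [pd_eq_comp l f, pd, fderiv_clm_apply hd (differentiableAt_const _)]
    simp
  rw [key, key]
  exact hs _ _

theorem IsSmoothOn.diffTens {T : Tens} {M : Set Pt} (hT : IsSmoothOn M T) (hM : IsOpen M)
    {p : Pt} (hp : p ∈ M) : DiffTens T p := fun a b =>
  ((hT a b).contDiffAt (hM.mem_nhds hp)).differentiableAt (by simp)

theorem IsSmoothOn.mul {S T : Tens} {M : Set Pt} (hS : IsSmoothOn M S) (hT : IsSmoothOn M T) :
    IsSmoothOn M (fun q => S q * T q) := fun a b => by
  simp only [Matrix.mul_apply]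
  exact ContDiffOn.sum fun c _ => (hS a c).mul (hT c b)

theorem IsSmoothOn.add {S T : Tens} {M : Set Pt} (hS : IsSmoothOn M S) (hT : IsSmoothOn M T) :
    IsSmoothOn M (fun q => S q + T q) := fun a b => (hS a b).add (hT a b)

theorem isSmoothOn_const (M : Set Pt) (K : Matrix (Fin 4) (Fin 4) ℝ) :
    IsSmoothOn M (fun _ => K) := fun _ _ => contDiffOn_const

theorem IsSmoothOn.pdMat {T : Tens} {M : Set Pt} (hT : IsSmoothOn M T) (hM : IsOpen M)
    (i : Fin 4) : IsSmoothOn M (pdMat i T) := fun a b => contDiffOn_pd hM (hT a b) i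

/-! ### Levi-Civita connection and curvature from an orthonormal coframe -/

/-- `E` is an orthonormal coframe for `g` on `M` (its rows are the covectors), `F` the dual frame
(its columns are the vectors) and `W i` the values at `∂ᵢ` of the connection forms. -/
structure IsMovingFrame (M : Set Pt) (g E F : Tens) (W : Fin 4 → Tens) : Prop where
  isOpen : IsOpen M
  smoothE : IsSmoothOn M E
  smoothF : IsSmoothOn M F
  smoothW : ∀ i, IsSmoothOn M (W i)
  metric : ∀ p ∈ M, g p = (E p)ᵀ * E p
  inv : ∀ p ∈ M, F p * E p = 1
  skew : ∀ i, ∀ p ∈ M, (W i p)ᵀ = -W i p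
  torsion : ∀ p ∈ M, ∀ a i j,
    (pdMat i E p + W i p * E p) a j = (pdMat j E p + W j p * E p) a i

/-- The Christoffel symbols as matrices. -/
def chrMat (g : Tens) (i : Fin 4) : Tens := fun p => Matrix.of fun k j => christoffel g k i j p

/-- The curvature forms `dω + ω ∧ ω` evaluated on `∂ᵢ, ∂ⱼ`. -/
def curvForm (W : Fin 4 → Tens) (i j : Fin 4) (p : Pt) : Matrix (Fin 4) (Fin 4) ℝ :=
  pdMat i (W j) p - pdMat j (W i) p + (W i p * W j p - W j p * W i p)

namespace IsMovingFrame

variable {M : Set Pt} {g E F : Tens} {W : Fin 4 → Tens} {p : Pt}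

theorem inv' (hf : IsMovingFrame M g E F W) (hp : p ∈ M) : E p * F p = 1 :=
  mul_eq_one_comm.mp (hf.inv p hp)

theorem smooth_metric (hf : IsMovingFrame M g E F W) : IsSmoothOn M g := fun a b =>
  ContDiffOn.congr (IsSmoothOn.mul (S := fun q => (E q)ᵀ) (fun a b => hf.smoothE b a)
    hf.smoothE a b) fun q hq => by rw [hf.metric q hq]

theorem isRiemannian (hf : IsMovingFrame M g E F W) : IsRiemannian M g := by
  refine ⟨hf.smooth_metric, fun p hp => ?_⟩
  rw [hf.metric p hp, ← Matrix.conjTranspose_eq_transpose_of_trivial]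
  refine Matrix.PosDef.conjTranspose_mul_self _ fun x y hxy => ?_
  have := congrArg (fun v => F p *ᵥ v) hxy
  simpa [Matrix.mulVec_mulVec, hf.inv p hp] using this

theorem metric_inv (hf : IsMovingFrame M g E F W) (hp : p ∈ M) :
    (g p)⁻¹ = F p * (F p)ᵀ := by
  apply Matrix.inv_eq_right_inv
  rw [hf.metric p hp, Matrix.mul_assoc, ← Matrix.mul_assoc (E p), hf.inv' hp, Matrix.one_mul,
    ← Matrix.transpose_mul, hf.inv p hp, Matrix.transpose_one]

theorem pdMat_metric (hf : IsMovingFrame M g E F W) (hp : p ∈ M) (i : Fin 4) :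
    pdMat i g p = (F p * (pdMat i E p + W i p * E p))ᵀ * g p
      + g p * (F p * (pdMat i E p + W i p * E p)) := by
  have hE := hf.smoothE.diffTens hf.isOpen hp
  have h1 : pdMat i g p = (pdMat i E p)ᵀ * E p + (E p)ᵀ * pdMat i E p := by
    rw [pdMat_congr hf.isOpen hp hf.metric, pdMat_mul hE.transpose hE, pdMat_transpose]
  have h2 : g p * (F p * (pdMat i E p + W i p * E p))
      = (E p)ᵀ * (pdMat i E p + W i p * E p) := by
    rw [hf.metric p hp, Matrix.mul_assoc, ← Matrix.mul_assoc (E p), hf.inv' hp, Matrix.one_mul]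
  have h3 : (g p)ᵀ = g p := by rw [hf.metric p hp]; simp
  have h4 : (F p * (pdMat i E p + W i p * E p))ᵀ * g p
      = (pdMat i E p + W i p * E p)ᵀ * E p := by
    have := congrArg Matrix.transpose h2
    rw [Matrix.transpose_mul, h3] at this
    rw [this, Matrix.transpose_mul, Matrix.transpose_transpose]
  rw [h1, h2, h4, Matrix.transpose_add, Matrix.transpose_mul, hf.skew i p hp]
  noncomm_ring

/-- Uniqueness of the Levi-Civita connection. The matrices `F (∂ᵢE + Wᵢ E)` are metric because `W`
is skew and symmetric in the lower indices because the torsion vanishes; Koszul's permutation of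
indices then identifies them with the Christoffel symbols. -/
theorem chrMat_eq (hf : IsMovingFrame M g E F W) (hp : p ∈ M) (i : Fin 4) :
    chrMat g i p = F p * (pdMat i E p + W i p * E p) := by
  set G : Fin 4 → Matrix (Fin 4) (Fin 4) ℝ := fun i => F p * (pdMat i E p + W i p * E p) with hG
  have hsym : ∀ i j m, G i m j = G j m i := fun i j m => by
    simp only [hG, Matrix.mul_apply (M := F p)]
    exact Finset.sum_congr rfl fun a _ => by rw [hf.torsion p hp]
  have hgs : ∀ l m, g p l m = g p m l := fun l m => by
    rw [hf.metric p hp]; simp only [Matrix.mul_apply, Matrix.transpose_apply, mul_comm]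
  have hpd : ∀ i j l, pd i (fun q => g q j l) p
      = ∑ m, (g p l m * G i m j + g p j m * G i m l) := fun i j l => by
    have := congrFun (congrFun (hf.pdMat_metric hp i) j) l
    simp only [pdMat, Matrix.of_apply, Matrix.add_apply] at this
    rw [this, Matrix.mul_apply, Matrix.mul_apply, ← Finset.sum_add_distrib]
    refine Finset.sum_congr rfl fun m _ => ?_
    rw [hgs m l, Matrix.transpose_apply, mul_comm (g p l m)]
    rfl
  have hdet : g p * (F p * (F p)ᵀ) = 1 := by
    rw [hf.metric p hp, Matrix.mul_assoc, ← Matrix.mul_assoc (E p), hf.inv' hp, Matrix.one_mul,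
      ← Matrix.transpose_mul, hf.inv p hp, Matrix.transpose_one]
  have hinv : (g p)⁻¹ * g p = 1 := by
    rw [hf.metric_inv hp]; exact mul_eq_one_comm.mp hdet
  ext k j
  have hcol : ∀ l, pd i (fun q => g q j l) p + pd j (fun q => g q i l) p
      - pd l (fun q => g q i j) p = 2 * ∑ m, g p l m * G i m j := fun l => by
    simp only [hpd, Finset.mul_sum, ← Finset.sum_add_distrib, ← Finset.sum_sub_distrib]
    refine Finset.sum_congr rfl fun m _ => ?_
    rw [hsym i l m, hsym j l m, hsym j i m]
    ring
  have : christoffel g k i j p = ((g p)⁻¹ * (g p * G i)) k j := by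
    simp only [christoffel, hcol, Matrix.mul_apply, Finset.mul_sum]
    exact Finset.sum_congr rfl fun l _ => Finset.sum_congr rfl fun m _ => by ring
  simp only [chrMat, Matrix.of_apply]
  rw [this, ← Matrix.mul_assoc, hinv, Matrix.one_mul]

theorem chr_symm (hf : IsMovingFrame M g E F W) (hp : p ∈ M) (i j k : Fin 4) :
    christoffel g k i j p = christoffel g k j i p := by
  have h1 := congrFun (congrFun (hf.chrMat_eq hp i) k) j
  have h2 := congrFun (congrFun (hf.chrMat_eq hp j) k) i
  simp only [chrMat, Matrix.of_apply] at h1 h2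
  rw [h1, h2, Matrix.mul_apply, Matrix.mul_apply]
  exact Finset.sum_congr rfl fun a _ => by rw [hf.torsion p hp]

theorem mul_chrMat (hf : IsMovingFrame M g E F W) (hp : p ∈ M) (i : Fin 4) :
    E p * chrMat g i p = pdMat i E p + W i p * E p := by
  rw [hf.chrMat_eq hp, ← Matrix.mul_assoc, hf.inv' hp, Matrix.one_mul]

theorem smooth_chrMat (hf : IsMovingFrame M g E F W) (i : Fin 4) : IsSmoothOn M (chrMat g i) :=
  fun a b => ContDiffOn.congr (hf.smoothF.mul ((hf.smoothE.pdMat hf.isOpen i).add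
    ((hf.smoothW i).mul hf.smoothE)) a b) fun q hq => by rw [hf.chrMat_eq hq]

/-- Apart from `∂ᵢWⱼ E` and `Wᵢ Wⱼ E`, the right-hand side is symmetric in `i, j`, so
antisymmetrising leaves exactly the curvature form. -/
theorem mul_pdMat_chrMat (hf : IsMovingFrame M g E F W) (hp : p ∈ M) (i j : Fin 4) :
    E p * (pdMat i (chrMat g j) p + chrMat g i p * chrMat g j p)
      = pdMat i (pdMat j E) p + pdMat i (W j) p * E p + W j p * pdMat i E p
        + W i p * pdMat j E p + W i p * W j p * E p := by
  have hE := hf.smoothE.diffTens hf.isOpen hp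
  have hW := (hf.smoothW j).diffTens hf.isOpen hp
  have hD := (hf.smoothE.pdMat hf.isOpen j).diffTens hf.isOpen hp
  have hC := (hf.smooth_chrMat j).diffTens hf.isOpen hp
  have h1 := pdMat_congr hf.isOpen hp (fun q hq => hf.mul_chrMat hq j) i
  rw [pdMat_mul hE hC, pdMat_add hD (hW.mul hE), pdMat_mul hW hE] at h1
  have h2 := hf.mul_chrMat hp i
  have h3 := hf.mul_chrMat hp j
  calc E p * (pdMat i (chrMat g j) p + chrMat g i p * chrMat g j p)
      = (pdMat i E p * chrMat g j p + E p * pdMat i (chrMat g j) p)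
        + (E p * chrMat g i p - pdMat i E p) * chrMat g j p := by noncomm_ring
    _ = pdMat i (pdMat j E) p + (pdMat i (W j) p * E p + W j p * pdMat i E p)
        + W i p * (E p * chrMat g j p) := by rw [h1, h2]; noncomm_ring
    _ = _ := by rw [h3]; noncomm_ring

/-- Cartan's second structure equation in coordinates. -/
theorem riem_eq (hf : IsMovingFrame M g E F W) (hp : p ∈ M) (i j l k : Fin 4) :
    riem g l k i j p = (F p * (curvForm W i j p * E p)) l k := by
  have h1 : riem g l k i j p = ((pdMat i (chrMat g j) p + chrMat g i p * chrMat g j p)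
      - (pdMat j (chrMat g i) p + chrMat g j p * chrMat g i p)) l k := by
    simp only [riem, Matrix.sub_apply, Matrix.add_apply, Matrix.mul_apply, chrMat, pdMat,
      Matrix.of_apply, Finset.sum_sub_distrib]
    ring
  have hcomm : pdMat i (pdMat j E) p = pdMat j (pdMat i E) p := by
    ext a b
    exact pd_comm hf.isOpen (hf.smoothE a b) hp i j
  have h2 : E p * ((pdMat i (chrMat g j) p + chrMat g i p * chrMat g j p)
      - (pdMat j (chrMat g i) p + chrMat g j p * chrMat g i p)) = curvForm W i j p * E p := by
    rw [Matrix.mul_sub, hf.mul_pdMat_chrMat hp, hf.mul_pdMat_chrMat hp, hcomm, curvForm]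
    noncomm_ring
  rw [h1, ← h2, ← Matrix.mul_assoc, hf.inv p hp, Matrix.one_mul]

end IsMovingFrame

/-! ## The frame of the explicit metric -/

/-- `f` is differentiable at `p` with partial derivatives `v`. -/
def HasGrad (f : Pt → ℝ) (v : Fin 4 → ℝ) (p : Pt) : Prop :=
  DifferentiableAt ℝ f p ∧ ∀ i, pd i f p = v i

namespace HasGrad

variable {f k : Pt → ℝ} {v w : Fin 4 → ℝ} {p : Pt}

theorem const (c : ℝ) : HasGrad (fun _ => c) (fun _ => 0) p :=
  ⟨differentiableAt_const c, fun i => pd_const c i p⟩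

theorem coord (j : Fin 4) : HasGrad (fun q => q j) (fun i => dcoord j i) p := by
  refine ⟨by fun_prop, fun i => ?_⟩
  have h := (ContinuousLinearMap.proj (R := ℝ) (φ := fun _ : Fin 4 => ℝ) j).hasFDerivAt (x := p)
  have h' : fderiv ℝ (fun q : Pt => q j) p = ContinuousLinearMap.proj j := h.fderiv
  simp [pd, h', dcoord, Pi.single_apply, eq_comm]

theorem add (hf : HasGrad f v p) (hk : HasGrad k w p) :
    HasGrad (fun q => f q + k q) (fun i => v i + w i) p :=
  ⟨hf.1.add hk.1, fun i => by rw [pd_add hf.1 hk.1, hf.2, hk.2]⟩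

theorem mul (hf : HasGrad f v p) (hk : HasGrad k w p) :
    HasGrad (fun q => f q * k q) (fun i => v i * k p + f p * w i) p :=
  ⟨hf.1.mul hk.1, fun i => by rw [pd_mul hf.1 hk.1, hf.2, hk.2]⟩

theorem const_mul (c : ℝ) (hf : HasGrad f v p) :
    HasGrad (fun q => c * f q) (fun i => c * v i) p :=
  ⟨(HasGrad.const c).1.mul hf.1, fun i => by
    rw [pd_mul (HasGrad.const c).1 hf.1, hf.2, pd_const]; ring⟩

theorem neg (hf : HasGrad f v p) : HasGrad (fun q => -f q) (fun i => -v i) p := by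
  simpa using hf.const_mul (-1)

theorem sub (hf : HasGrad f v p) (hk : HasGrad k w p) :
    HasGrad (fun q => f q - k q) (fun i => v i - w i) p := by
  simpa [sub_eq_add_neg] using hf.add hk.neg

theorem sin (hf : HasGrad f v p) :
    HasGrad (fun q => Real.sin (f q)) (fun i => Real.cos (f p) * v i) p :=
  ⟨hf.1.sin, fun i => by
    have := hf.2 i
    simp only [pd] at this ⊢
    rw [fderiv_sin hf.1]; simp [this]⟩

theorem cos (hf : HasGrad f v p) :
    HasGrad (fun q => Real.cos (f q)) (fun i => -Real.sin (f p) * v i) p :=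
  ⟨hf.1.cos, fun i => by
    have := hf.2 i
    simp only [pd] at this ⊢
    rw [fderiv_cos hf.1]; simp [this]⟩

theorem congr (hf : HasGrad f v p) (h : ∀ i, v i = w i) : HasGrad f w p :=
  ⟨hf.1, fun i => (hf.2 i).trans (h i)⟩

theorem base {f : ℝ × ℝ → ℝ} (hf : DifferentiableAt ℝ f (base p)) :
    HasGrad (fun q => f (KSurf.base q))
      (fun i => dX f (KSurf.base p) * dcoord 0 i + dY f (KSurf.base p) * dcoord 1 i) p := by
  have hb : HasFDerivAt KSurf.base
      ((ContinuousLinearMap.proj (R := ℝ) (φ := fun _ : Fin 4 => ℝ) 0).prod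
        (ContinuousLinearMap.proj (R := ℝ) (φ := fun _ : Fin 4 => ℝ) 1)) p :=
    ContinuousLinearMap.hasFDerivAt
      ((ContinuousLinearMap.proj (R := ℝ) (φ := fun _ : Fin 4 => ℝ) 0).prod
        (ContinuousLinearMap.proj (R := ℝ) (φ := fun _ : Fin 4 => ℝ) 1))
  have hc := hf.hasFDerivAt.comp p hb
  refine ⟨hc.differentiableAt, fun i => ?_⟩
  have h' : fderiv ℝ (fun q => f (KSurf.base q)) p = _ := hc.fderiv
  have hlin : ∀ a b : ℝ, fderiv ℝ f (KSurf.base p) (a, b)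
      = fderiv ℝ f (KSurf.base p) (1, 0) * a + fderiv ℝ f (KSurf.base p) (0, 1) * b := by
    intro a b
    have : ((a, b) : ℝ × ℝ) = a • (1, 0) + b • (0, 1) := by simp
    rw [this, map_add, map_smul, map_smul, smul_eq_mul, smul_eq_mul]; ring
  rw [pd, h']
  rw [ContinuousLinearMap.comp_apply, ContinuousLinearMap.prod_apply,
    ContinuousLinearMap.proj_apply, ContinuousLinearMap.proj_apply, hlin]
  simp only [dX, dY, dcoord]
  fin_cases i <;> simp

end HasGrad

theorem isOpen_dom {U : Set (ℝ × ℝ)} (hU : IsOpen U) : IsOpen (dom U) := by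
  have hb : Continuous base := by unfold base; fun_prop
  exact (hU.preimage hb).inter ((isOpen_lt continuous_const (continuous_apply 2)).inter
    (isOpen_lt (continuous_apply 2) continuous_const))

theorem contDiffOn_base {U : Set (ℝ × ℝ)} {f : ℝ × ℝ → ℝ} (hf : ContDiffOn ℝ ∞ f U) :
    ContDiffOn ℝ ∞ (fun q => f (base q)) (dom U) :=
  hf.comp (t := U) (g := f) (f := base) (s := dom U)
    (by unfold base; fun_prop) fun _ hq => hq.1

theorem contDiffOn_dX {U : Set (ℝ × ℝ)} (hU : IsOpen U) {f : ℝ × ℝ → ℝ}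
    (hf : ContDiffOn ℝ ∞ f U) : ContDiffOn ℝ ∞ (dX f) U :=
  (hf.fderiv_of_isOpen hU (by simp)).clm_apply contDiffOn_const

theorem contDiffOn_dY {U : Set (ℝ × ℝ)} (hU : IsOpen U) {f : ℝ × ℝ → ℝ}
    (hf : ContDiffOn ℝ ∞ f U) : ContDiffOn ℝ ∞ (dY f) U :=
  (hf.fderiv_of_isOpen hU (by simp)).clm_apply contDiffOn_const

theorem contDiffOn_logF {U : Set (ℝ × ℝ)} {f : ℝ × ℝ → ℝ} (hf : ContDiffOn ℝ ∞ f U)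
    (hpos : ∀ q ∈ U, 0 < f q) : ContDiffOn ℝ ∞ (logF f) U :=
  hf.log fun q hq => (hpos q hq).ne'

/-- Writing derivatives of `f` as `f` times derivatives of `ln f` keeps the later identities
polynomial. -/
theorem fderiv_logF {f : ℝ × ℝ → ℝ} {q : ℝ × ℝ} (hf : DifferentiableAt ℝ f q) (hpos : 0 < f q)
    (w : ℝ × ℝ) : fderiv ℝ f q w = f q * fderiv ℝ (logF f) q w := by
  unfold logF
  rw [fderiv.log hf hpos.ne']
  simp only [smul_apply, smul_eq_mul]
  field_simp

/-- The form `H (sin t dx + cos t dy)`. -/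
def alphaF (H : ℝ × ℝ → ℝ) : OneForm := fun p i =>
  H (base p) * (Real.sin (p 3) * dcoord 0 i + Real.cos (p 3) * dcoord 1 i)

/-- The form `H (cos t dx - sin t dy)`. -/
def betaF (H : ℝ × ℝ → ℝ) : OneForm := fun p i =>
  H (base p) * (Real.cos (p 3) * dcoord 0 i - Real.sin (p 3) * dcoord 1 i)

/-- The form `-⋆d(ln f)`. -/
def starF (f : ℝ × ℝ → ℝ) : OneForm := fun p i =>
  dY (logF f) (base p) * dcoord 0 i - dX (logF f) (base p) * dcoord 1 i

/-- The form `dt - ⋆d(ln H)`. -/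
def tauF (H : ℝ × ℝ → ℝ) : OneForm := fun p i => dcoord 3 i + starF H p i

/-- The connection form `ω²₃` in the fibre direction. -/
def phiF (H : ℝ × ℝ → ℝ) : OneForm := fun p i =>
  Real.cos (p 2) * tauF H p i + Real.sin (p 2) * betaF H p i

/-- The connection form `ω⁰₁` in the base direction. -/
def rotF (h H : ℝ × ℝ → ℝ) : OneForm := fun p i =>
  1 / 2 * ((1 - Real.cos (p 2)) * tauF H p i - Real.sin (p 2) * betaF H p i) + starF h p i

theorem theta3_eq (H : ℝ × ℝ → ℝ) (p : Pt) (i : Fin 4) :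
    theta3 H p i = Real.sin (p 2) * tauF H p i - Real.cos (p 2) * betaF H p i := by
  fin_cases i <;> simp [theta3, tauF, starF, betaF, dcoord] <;> ring

theorem theta4_eq (H : ℝ × ℝ → ℝ) (p : Pt) (i : Fin 4) :
    theta4 H p i = dcoord 2 i - alphaF H p i := by
  fin_cases i <;> simp [theta4, alphaF, dcoord] <;> ring

/-- The orthonormal coframe. -/
def coframe (h H : ℝ × ℝ → ℝ) : Tens := fun p => Matrix.of
  ![fun i => Real.cos (p 2 / 2) * h (base p) * dcoord 0 i,
    fun i => Real.cos (p 2 / 2) * h (base p) * dcoord 1 i, theta3 H p, theta4 H p]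

/-- The dual frame. -/
def dualFrame (h H : ℝ × ℝ → ℝ) : Tens := fun p =>
  !![1 / (Real.cos (p 2 / 2) * h (base p)), 0, 0, 0;
    0, 1 / (Real.cos (p 2 / 2) * h (base p)), 0, 0;
    Real.sin (p 3) * H (base p) / (Real.cos (p 2 / 2) * h (base p)),
      Real.cos (p 3) * H (base p) / (Real.cos (p 2 / 2) * h (base p)), 0, 1;
    -theta3 H p 0 / (Real.sin (p 2) * (Real.cos (p 2 / 2) * h (base p))),
      -theta3 H p 1 / (Real.sin (p 2) * (Real.cos (p 2 / 2) * h (base p))),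
      1 / Real.sin (p 2), 0]

/-- The form `½ sin(z/2) h dxⁱ`. -/
def mixF (h : ℝ × ℝ → ℝ) (k : Fin 4) : OneForm := fun p i =>
  1 / 2 * Real.sin (p 2 / 2) * h (base p) * dcoord k i

/-- The connection matrix of the coframe. -/
def connMat (h H : ℝ × ℝ → ℝ) (i : Fin 4) : Tens := fun p =>
  !![0, rotF h H p i, mixF h 1 p i, -mixF h 0 p i;
    -rotF h H p i, 0, -mixF h 0 p i, -mixF h 1 p i;
    -mixF h 1 p i, mixF h 0 p i, 0, phiF H p i;
    mixF h 0 p i, mixF h 1 p i, -phiF H p i, 0]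

theorem connMat_skew (h H : ℝ × ℝ → ℝ) (i : Fin 4) (p : Pt) :
    (connMat h H i p)ᵀ = -connMat h H i p := by
  ext a b
  fin_cases a <;> fin_cases b <;> simp [connMat]

/-- The assumptions on `U`, `h` and `H`. -/
structure Admissible (U : Set (ℝ × ℝ)) (h H : ℝ × ℝ → ℝ) : Prop where
  isOpen : IsOpen U
  h_smooth : ContDiffOn ℝ ∞ h U
  H_smooth : ContDiffOn ℝ ∞ H U
  h_pos : ∀ q ∈ U, 0 < h q
  H_pos : ∀ q ∈ U, 0 < H q
  lap_eq : ∀ q ∈ U, lap (logF H) q = (1 / 2) * h q ^ 2 - H q ^ 2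

theorem cos_half_pos {U : Set (ℝ × ℝ)} {p : Pt} (hp : p ∈ dom U) : 0 < Real.cos (p 2 / 2) :=
  Real.cos_pos_of_mem_Ioo ⟨by linarith [hp.2.1, Real.pi_pos], by linarith [hp.2.2]⟩

theorem sin_half_pos {U : Set (ℝ × ℝ)} {p : Pt} (hp : p ∈ dom U) : 0 < Real.sin (p 2 / 2) :=
  Real.sin_pos_of_pos_of_lt_pi (by linarith [hp.2.1]) (by linarith [hp.2.2, hp.2.1])

theorem sin_pos' {U : Set (ℝ × ℝ)} {p : Pt} (hp : p ∈ dom U) : 0 < Real.sin (p 2) :=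
  Real.sin_pos_of_pos_of_lt_pi hp.2.1 hp.2.2

theorem sin_eq_half (z : ℝ) : Real.sin z = 2 * Real.sin (z / 2) * Real.cos (z / 2) := by
  rw [← Real.sin_two_mul]; congr 1; ring

theorem cos_eq_half (z : ℝ) : Real.cos z = Real.cos (z / 2) ^ 2 - Real.sin (z / 2) ^ 2 := by
  rw [← Real.cos_two_mul']; congr 1; ring

/-- The exterior derivative of a one-form. -/
def extD1 (a : OneForm) (p : Pt) (i j : Fin 4) : ℝ :=
  pd i (fun q => a q j) p - pd j (fun q => a q i) p

/-! ### Exterior derivatives of the auxiliary one-forms -/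

namespace Admissible

variable {U : Set (ℝ × ℝ)} {h H : ℝ × ℝ → ℝ} (hA : Admissible U h H) {p : Pt} (hp : p ∈ dom U)
include hA hp

theorem differentiableAt_of {f : ℝ × ℝ → ℝ} (hf : ContDiffOn ℝ ∞ f U) :
    DifferentiableAt ℝ f (base p) :=
  (hf.contDiffAt (hA.isOpen.mem_nhds hp.1)).differentiableAt (by simp)

theorem hasGrad_h : HasGrad (fun q => h (base q)) (fun i => h (base p) *
    (dX (logF h) (base p) * dcoord 0 i + dY (logF h) (base p) * dcoord 1 i)) p := by
  have hd := hA.differentiableAt_of hp hA.h_smooth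
  refine (HasGrad.base hd).congr fun i => ?_
  rw [dX, dY, fderiv_logF hd (hA.h_pos _ hp.1), fderiv_logF hd (hA.h_pos _ hp.1), dX, dY]
  ring

theorem hasGrad_H : HasGrad (fun q => H (base q)) (fun i => H (base p) *
    (dX (logF H) (base p) * dcoord 0 i + dY (logF H) (base p) * dcoord 1 i)) p := by
  have hd := hA.differentiableAt_of hp hA.H_smooth
  refine (HasGrad.base hd).congr fun i => ?_
  rw [dX, dY, fderiv_logF hd (hA.H_pos _ hp.1), fderiv_logF hd (hA.H_pos _ hp.1), dX, dY]
  ring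

theorem hasGrad_starF {f : ℝ × ℝ → ℝ} (hf : ContDiffOn ℝ ∞ (logF f) U) (j : Fin 4) :
    HasGrad (fun q => starF f q j) (fun i =>
      (dX (dY (logF f)) (base p) * dcoord 0 i + dY (dY (logF f)) (base p) * dcoord 1 i)
        * dcoord 0 j
      - (dX (dX (logF f)) (base p) * dcoord 0 i + dY (dX (logF f)) (base p) * dcoord 1 i)
        * dcoord 1 j) p := by
  have hx := HasGrad.base (hA.differentiableAt_of hp (contDiffOn_dX hA.isOpen hf))
  have hy := HasGrad.base (hA.differentiableAt_of hp (contDiffOn_dY hA.isOpen hf))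
  exact ((hy.mul (.const (dcoord 0 j))).sub (hx.mul (.const (dcoord 1 j)))).congr
    fun i => by ring

theorem hasGrad_tauF (j : Fin 4) : HasGrad (fun q => tauF H q j) (fun i =>
      (dX (dY (logF H)) (base p) * dcoord 0 i + dY (dY (logF H)) (base p) * dcoord 1 i)
        * dcoord 0 j
      - (dX (dX (logF H)) (base p) * dcoord 0 i + dY (dX (logF H)) (base p) * dcoord 1 i)
        * dcoord 1 j) p :=
  ((HasGrad.const (dcoord 3 j)).add
    (hA.hasGrad_starF hp (contDiffOn_logF hA.H_smooth hA.H_pos) j)).congr fun i => by ring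

theorem hasGrad_alphaF (j : Fin 4) : HasGrad (fun q => alphaF H q j) (fun i =>
    (dX (logF H) (base p) * dcoord 0 i + dY (logF H) (base p) * dcoord 1 i) * alphaF H p j
      + dcoord 3 i * betaF H p j) p :=
  ((hA.hasGrad_H hp).mul (((HasGrad.coord 3).sin.mul (.const (dcoord 0 j))).add
    ((HasGrad.coord 3).cos.mul (.const (dcoord 1 j))))).congr fun i => by
      simp only [alphaF, betaF]; ring

theorem hasGrad_betaF (j : Fin 4) : HasGrad (fun q => betaF H q j) (fun i =>
    (dX (logF H) (base p) * dcoord 0 i + dY (logF H) (base p) * dcoord 1 i) * betaF H p j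
      - dcoord 3 i * alphaF H p j) p :=
  ((hA.hasGrad_H hp).mul (((HasGrad.coord 3).cos.mul (.const (dcoord 0 j))).sub
    ((HasGrad.coord 3).sin.mul (.const (dcoord 1 j))))).congr fun i => by
      simp only [alphaF, betaF]; ring

theorem extD1_starF {f : ℝ × ℝ → ℝ} (hf : ContDiffOn ℝ ∞ (logF f) U) (i j : Fin 4) :
    extD1 (starF f) p i j = -lap (logF f) (base p) * wedge (dcoord 0) (dcoord 1) i j := by
  rw [extD1, (hA.hasGrad_starF hp hf j).2, (hA.hasGrad_starF hp hf i).2]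
  simp only [wedge, Matrix.of_apply, lap]
  ring

/-- The only place where the differential equation for `H` enters: `d⋆d ln H` is the Laplacian of
`ln H`. -/
theorem extD1_tauF (i j : Fin 4) : extD1 (tauF H) p i j
    = (H (base p) ^ 2 - 1 / 2 * h (base p) ^ 2) * wedge (dcoord 0) (dcoord 1) i j := by
  have := hA.lap_eq _ hp.1
  rw [extD1, (hA.hasGrad_tauF hp j).2, (hA.hasGrad_tauF hp i).2]
  simp only [wedge, Matrix.of_apply, lap] at this ⊢
  linear_combination (-(dcoord 0 i * dcoord 1 j - dcoord 0 j * dcoord 1 i)) * this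

theorem extD1_alphaF (i j : Fin 4) :
    extD1 (alphaF H) p i j = wedge (tauF H p) (betaF H p) i j := by
  rw [extD1, (hA.hasGrad_alphaF hp j).2, (hA.hasGrad_alphaF hp i).2]
  simp only [wedge, Matrix.of_apply, tauF, starF, alphaF, betaF]
  ring

theorem extD1_betaF (i j : Fin 4) :
    extD1 (betaF H) p i j = -wedge (tauF H p) (alphaF H p) i j := by
  rw [extD1, (hA.hasGrad_betaF hp j).2, (hA.hasGrad_betaF hp i).2]
  simp only [wedge, Matrix.of_apply, tauF, starF, alphaF, betaF]
  ring

end Admissible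

theorem HasGrad.self {f : Pt → ℝ} {v : Fin 4 → ℝ} {p : Pt} (hf : HasGrad f v p) :
    HasGrad f (fun i => pd i f p) p := ⟨hf.1, fun _ => rfl⟩

theorem extD1_smul {f : Pt → ℝ} {v : Fin 4 → ℝ} {a : OneForm} {w : Fin 4 → Fin 4 → ℝ} {p : Pt}
    (hf : HasGrad f v p) (ha : ∀ j, HasGrad (fun q => a q j) (w j) p) (i j : Fin 4) :
    extD1 (fun q k => f q * a q k) p i j = f p * extD1 a p i j + wedge v (a p) i j := by
  simp only [extD1, wedge, Matrix.of_apply]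
  rw [(hf.mul (ha j).self).2, (hf.mul (ha i).self).2]
  ring

theorem extD1_add {a b : OneForm} {v w : Fin 4 → Fin 4 → ℝ} {p : Pt}
    (ha : ∀ j, HasGrad (fun q => a q j) (v j) p) (hb : ∀ j, HasGrad (fun q => b q j) (w j) p)
    (i j : Fin 4) :
    extD1 (fun q k => a q k + b q k) p i j = extD1 a p i j + extD1 b p i j := by
  simp only [extD1]
  rw [((ha j).self.add (hb j).self).2, ((ha i).self.add (hb i).self).2]
  ring

theorem extD1_const (w : Fin 4 → ℝ) (p : Pt) (i j : Fin 4) : extD1 (fun _ => w) p i j = 0 := by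
  simp [extD1, pd_const]

theorem hasGrad_half (p : Pt) : HasGrad (fun q => q 2 / 2) (fun i => 1 / 2 * dcoord 2 i) p := by
  simpa [div_eq_inv_mul] using (HasGrad.coord (p := p) 2).const_mul (1 / 2)

namespace Admissible

variable {U : Set (ℝ × ℝ)} {h H : ℝ × ℝ → ℝ} (hA : Admissible U h H) {p : Pt} (hp : p ∈ dom U)
include hA hp

/-- The pair `φ, θ₃` is `τ, β` rotated through the angle `z`. The `H²` term of `dτ` is absorbed by
`β ∧ α = H² dx ∧ dy`, so only the `h²` term survives; the same happens for `θ₃`. -/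
theorem extD1_phiF (i j : Fin 4) : extD1 (phiF H) p i j = wedge (theta3 H p) (theta4 H p) i j
    - Real.cos (p 2) * (1 / 2 * h (base p) ^ 2) * wedge (dcoord 0) (dcoord 1) i j := by
  have hc := (HasGrad.coord (p := p) 2).cos
  have hs := (HasGrad.coord (p := p) 2).sin
  have h1 := fun k => hA.hasGrad_tauF hp k
  have h2 := fun k => hA.hasGrad_betaF hp k
  have h3 := Real.sin_sq_add_cos_sq (p 3)
  unfold phiF
  rw [extD1_add (fun k => hc.mul (h1 k)) (fun k => hs.mul (h2 k)), extD1_smul hc h1,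
    extD1_smul hs h2, hA.extD1_tauF hp, hA.extD1_betaF hp]
  simp only [wedge, Matrix.of_apply, theta3_eq, theta4_eq, alphaF, betaF]
  linear_combination (-Real.cos (p 2) * H (base p) ^ 2
    * (dcoord 0 i * dcoord 1 j - dcoord 0 j * dcoord 1 i)) * h3

theorem extD1_theta3 (i j : Fin 4) : extD1 (theta3 H) p i j
    = -wedge (phiF H p) (theta4 H p) i j
    - Real.sin (p 2) * (1 / 2 * h (base p) ^ 2) * wedge (dcoord 0) (dcoord 1) i j := by
  have hc := (HasGrad.coord (p := p) 2).cos.neg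
  have hs := (HasGrad.coord (p := p) 2).sin
  have h1 := fun k => hA.hasGrad_tauF hp k
  have h2 := fun k => hA.hasGrad_betaF hp k
  have h3 := Real.sin_sq_add_cos_sq (p 3)
  have h4 : theta3 H = fun q k => Real.sin (q 2) * tauF H q k + -Real.cos (q 2) * betaF H q k := by
    ext q k; rw [theta3_eq]; ring
  rw [h4, extD1_add (fun k => hs.mul (h1 k)) (fun k => hc.mul (h2 k)), extD1_smul hs h1,
    extD1_smul hc h2, hA.extD1_tauF hp, hA.extD1_betaF hp]
  simp only [wedge, Matrix.of_apply, phiF, theta4_eq, alphaF, betaF]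
  linear_combination (-Real.sin (p 2) * H (base p) ^ 2
    * (dcoord 0 i * dcoord 1 j - dcoord 0 j * dcoord 1 i)) * h3

theorem extD1_theta4 (i j : Fin 4) :
    extD1 (theta4 H) p i j = wedge (phiF H p) (theta3 H p) i j := by
  have h1 := fun k => hA.hasGrad_alphaF hp k
  have h3 := Real.sin_sq_add_cos_sq (p 2)
  have h4 : theta4 H = fun q k => dcoord 2 k + -1 * alphaF H q k := by
    ext q k; rw [theta4_eq]; ring
  rw [h4, extD1_add (fun k => .const (dcoord 2 k)) (fun k => (HasGrad.const (-1)).mul (h1 k)),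
    extD1_const (dcoord 2), extD1_smul (.const (-1)) h1, hA.extD1_alphaF hp]
  simp only [wedge, Matrix.of_apply, phiF, theta3_eq, betaF]
  linear_combination (tauF H p i * (H (base p) * (Real.cos (p 3) * dcoord 0 j
    - Real.sin (p 3) * dcoord 1 j)) - tauF H p j * (H (base p) * (Real.cos (p 3) * dcoord 0 i
    - Real.sin (p 3) * dcoord 1 i))) * h3

theorem extD1_rotF (i j : Fin 4) : extD1 (rotF h H) p i j
    = 1 / 2 * wedge (theta4 H p) (theta3 H p) i j
      + (1 / 2 * H (base p) ^ 2 - 1 / 2 * Real.sin (p 2 / 2) ^ 2 * h (base p) ^ 2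
        - lap (logF h) (base p)) * wedge (dcoord 0) (dcoord 1) i j := by
  have hc : HasGrad (fun q => 1 / 2 * (1 - Real.cos (q 2))) _ p :=
    ((HasGrad.const 1).sub (HasGrad.coord (p := p) 2).cos).const_mul (1 / 2)
  have hs : HasGrad (fun q => -(1 / 2) * Real.sin (q 2)) _ p :=
    (HasGrad.coord (p := p) 2).sin.const_mul (-(1 / 2))
  have h1 := fun k => hA.hasGrad_tauF hp k
  have h2 := fun k => hA.hasGrad_betaF hp k
  have hl := contDiffOn_logF hA.h_smooth hA.h_pos
  have h3 := Real.sin_sq_add_cos_sq (p 3)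
  have h5 := Real.sin_sq_add_cos_sq (p 2 / 2)
  have h6 := cos_eq_half (p 2)
  have h4 : rotF h H = fun q k => (1 / 2 * (1 - Real.cos (q 2)) * tauF H q k
      + -(1 / 2) * Real.sin (q 2) * betaF H q k) + starF h q k := by
    ext q k; rw [rotF]; ring
  rw [h4, extD1_add (fun k => (hc.mul (h1 k)).add (hs.mul (h2 k)))
      (fun k => hA.hasGrad_starF hp hl k),
    extD1_add (fun k => hc.mul (h1 k)) (fun k => hs.mul (h2 k)), extD1_smul hc h1,
    extD1_smul hs h2, hA.extD1_tauF hp, hA.extD1_betaF hp, hA.extD1_starF hp hl]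
  simp only [wedge, Matrix.of_apply, theta3_eq, theta4_eq, alphaF, betaF]
  linear_combination (1 / 2 * Real.cos (p 2) * H (base p) ^ 2
    * (dcoord 0 i * dcoord 1 j - dcoord 0 j * dcoord 1 i)) * h3
    + (1 / 4 * h (base p) ^ 2 * (dcoord 0 i * dcoord 1 j - dcoord 0 j * dcoord 1 i)) * (h6 + h5)

theorem extD1_mixF (k i j : Fin 4) : extD1 (mixF h k) p i j
    = 1 / 4 * Real.cos (p 2 / 2) * h (base p) * wedge (dcoord 2) (dcoord k) i j
      + 1 / 2 * Real.sin (p 2 / 2) * h (base p) *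
        (dX (logF h) (base p) * wedge (dcoord 0) (dcoord k) i j
          + dY (logF h) (base p) * wedge (dcoord 1) (dcoord k) i j) := by
  have hs := ((hasGrad_half p).sin.const_mul (1 / 2)).mul (hA.hasGrad_h hp)
  unfold mixF
  rw [extD1_smul hs fun l => .const (dcoord k l), extD1_const]
  simp only [wedge, Matrix.of_apply]
  ring

theorem extD1_baseCoframe (k i j : Fin 4) :
    extD1 (fun q l => Real.cos (q 2 / 2) * h (base q) * dcoord k l) p i j
    = -(1 / 2) * Real.sin (p 2 / 2) * h (base p) * wedge (dcoord 2) (dcoord k) i j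
      + Real.cos (p 2 / 2) * h (base p) *
        (dX (logF h) (base p) * wedge (dcoord 0) (dcoord k) i j
          + dY (logF h) (base p) * wedge (dcoord 1) (dcoord k) i j) := by
  have hs := (hasGrad_half p).cos.mul (hA.hasGrad_h hp)
  rw [extD1_smul hs fun l => .const (dcoord k l), extD1_const]
  simp only [wedge, Matrix.of_apply]
  ring

end Admissible

/-! ### Model matrices and the model curvature -/

/-- The matrix in the frame of the Kähler structure. -/
def frameKahler : Matrix (Fin 4) (Fin 4) ℝ :=
  !![0, -1, 0, 0; 1, 0, 0, 0; 0, 0, 0, 1; 0, 0, -1, 0]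

/-- The matrix in the frame of the opposite Hermitian structure. -/
def frameHerm : Matrix (Fin 4) (Fin 4) ℝ :=
  !![0, -1, 0, 0; 1, 0, 0, 0; 0, 0, 0, -1; 0, 0, 1, 0]

/-- The curvature operator with holomorphic curvature `1`, except in the base direction, where it
is `A`. -/
def modelCurv (A : ℝ) (x y : Fin 4 → ℝ) : Matrix (Fin 4) (Fin 4) ℝ :=
  (1 / 4 : ℝ) • (wedge x y + wedge (frameKahler *ᵥ x) (frameKahler *ᵥ y)
    + (2 * (x ⬝ᵥ frameKahler *ᵥ y)) • frameKahler)
    + ((A - 1) * wedge x y 0 1) •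
      !![0, 1, 0, 0; -1, 0, 0, 0; 0, 0, 0, 0; 0, 0, 0, 0]

/-- The curvature of the base direction. -/
def baseCurv (h H : ℝ × ℝ → ℝ) (p : Pt) : ℝ :=
  (1 / 2 * H (base p) ^ 2 - Real.sin (p 2 / 2) ^ 2 * h (base p) ^ 2 - lap (logF h) (base p))
    / (Real.cos (p 2 / 2) ^ 2 * h (base p) ^ 2)

theorem metric_eq (h H : ℝ × ℝ → ℝ) (p : Pt) :
    metric h H p = (coframe h H p)ᵀ * coframe h H p := by
  ext i j
  simp only [metric, Matrix.of_apply, Matrix.mul_apply, Fin.sum_univ_four,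
    Matrix.transpose_apply, coframe, Matrix.cons_val]
  ring

theorem curvForm_apply (W : Fin 4 → Tens) (i j : Fin 4) (p : Pt) (a b : Fin 4) :
    curvForm W i j p a b = extD1 (fun q k => W k q a b) p i j
      + ∑ c, (W i p a c * W j p c b - W j p a c * W i p c b) := by
  simp only [curvForm, Matrix.add_apply, Matrix.sub_apply, Matrix.mul_apply, pdMat,
    Matrix.of_apply, extD1, Finset.sum_sub_distrib]

theorem extD1_neg (a : OneForm) (p : Pt) (i j : Fin 4) :
    extD1 (fun q k => -a q k) p i j = -extD1 a p i j := by
  simp only [extD1, pd, fderiv_fun_neg, neg_apply]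
  ring

theorem extD1_connMat (h H : ℝ × ℝ → ℝ) (p : Pt) (a b i j : Fin 4) : extD1 (fun q k => connMat h H k q a b) p i j =
    !![0, extD1 (rotF h H) p i j, extD1 (mixF h 1) p i j, -extD1 (mixF h 0) p i j;
    -extD1 (rotF h H) p i j, 0, -extD1 (mixF h 0) p i j, -extD1 (mixF h 1) p i j;
    -extD1 (mixF h 1) p i j, extD1 (mixF h 0) p i j, 0, extD1 (phiF H) p i j;
    extD1 (mixF h 0) p i j, extD1 (mixF h 1) p i j, -extD1 (phiF H) p i j, 0] a b := by
  fin_cases a <;> fin_cases b <;>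
    first | exact extD1_const 0 p i j | exact extD1_neg _ p i j | rfl

/-! ### Smoothness of the coframe, the dual frame and the connection -/

theorem contDiffOn_coord {M : Set Pt} (k : Fin 4) : ContDiffOn ℝ ∞ (fun q : Pt => q k) M := by
  fun_prop

namespace Admissible

variable {U : Set (ℝ × ℝ)} {h H : ℝ × ℝ → ℝ} (hA : Admissible U h H) {p : Pt}
include hA

theorem contDiffOn_starF {f : ℝ × ℝ → ℝ} (hf : ContDiffOn ℝ ∞ (logF f) U) (i : Fin 4) :
    ContDiffOn ℝ ∞ (fun q => starF f q i) (dom U) :=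
  ((contDiffOn_base (contDiffOn_dY hA.isOpen hf)).mul contDiffOn_const).sub
    ((contDiffOn_base (contDiffOn_dX hA.isOpen hf)).mul contDiffOn_const)

theorem contDiffOn_tauF (i : Fin 4) : ContDiffOn ℝ ∞ (fun q => tauF H q i) (dom U) :=
  contDiffOn_const.add (hA.contDiffOn_starF (contDiffOn_logF hA.H_smooth hA.H_pos) i)

theorem contDiffOn_alphaF (i : Fin 4) : ContDiffOn ℝ ∞ (fun q => alphaF H q i) (dom U) :=
  (contDiffOn_base hA.H_smooth).mul (((contDiffOn_coord 3).sin.mul contDiffOn_const).add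
    ((contDiffOn_coord 3).cos.mul contDiffOn_const))

theorem contDiffOn_betaF (i : Fin 4) : ContDiffOn ℝ ∞ (fun q => betaF H q i) (dom U) :=
  (contDiffOn_base hA.H_smooth).mul (((contDiffOn_coord 3).cos.mul contDiffOn_const).sub
    ((contDiffOn_coord 3).sin.mul contDiffOn_const))

theorem contDiffOn_phiF (i : Fin 4) : ContDiffOn ℝ ∞ (fun q => phiF H q i) (dom U) :=
  ((contDiffOn_coord 2).cos.mul (hA.contDiffOn_tauF i)).add
    ((contDiffOn_coord 2).sin.mul (hA.contDiffOn_betaF i))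

theorem contDiffOn_rotF (i : Fin 4) : ContDiffOn ℝ ∞ (fun q => rotF h H q i) (dom U) :=
  (contDiffOn_const.mul (((contDiffOn_const.sub (contDiffOn_coord 2).cos).mul
    (hA.contDiffOn_tauF i)).sub ((contDiffOn_coord 2).sin.mul (hA.contDiffOn_betaF i)))).add
    (hA.contDiffOn_starF (contDiffOn_logF hA.h_smooth hA.h_pos) i)

theorem contDiffOn_mixF (k i : Fin 4) : ContDiffOn ℝ ∞ (fun q => mixF h k q i) (dom U) :=
  ((contDiffOn_const.mul ((contDiffOn_coord 2).div_const 2).sin).mul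
    (contDiffOn_base hA.h_smooth)).mul contDiffOn_const

theorem contDiffOn_theta3 (i : Fin 4) : ContDiffOn ℝ ∞ (fun q => theta3 H q i) (dom U) := by
  simp only [theta3_eq]
  exact ((contDiffOn_coord 2).sin.mul (hA.contDiffOn_tauF i)).sub
    ((contDiffOn_coord 2).cos.mul (hA.contDiffOn_betaF i))

theorem contDiffOn_theta4 (i : Fin 4) : ContDiffOn ℝ ∞ (fun q => theta4 H q i) (dom U) := by
  simp only [theta4_eq]
  exact contDiffOn_const.sub (hA.contDiffOn_alphaF i)

theorem contDiffOn_scale : ContDiffOn ℝ ∞ (fun q => Real.cos (q 2 / 2) * h (base q)) (dom U) :=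
  ((contDiffOn_coord 2).div_const 2).cos.mul (contDiffOn_base hA.h_smooth)

theorem smooth_coframe : IsSmoothOn (dom U) (coframe h H) := by
  intro a j
  fin_cases a
  · exact hA.contDiffOn_scale.mul contDiffOn_const
  · exact hA.contDiffOn_scale.mul contDiffOn_const
  · exact hA.contDiffOn_theta3 j
  · exact hA.contDiffOn_theta4 j

theorem smooth_dualFrame : IsSmoothOn (dom U) (dualFrame h H) := by
  have hH := contDiffOn_base hA.H_smooth
  have h3 := hA.contDiffOn_theta3
  have hc := hA.contDiffOn_scale
  have hc' : ∀ q ∈ dom U, Real.cos (q 2 / 2) * h (base q) ≠ 0 := fun q hq =>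
    (mul_pos (cos_half_pos hq) (hA.h_pos _ hq.1)).ne'
  have hs : ContDiffOn ℝ ∞ (fun q : Pt => Real.sin (q 2)) (dom U) := (contDiffOn_coord 2).sin
  have hs' : ∀ q ∈ dom U, Real.sin (q 2) ≠ 0 := fun q hq => (sin_pos' hq).ne'
  have hsc' : ∀ q ∈ dom U, Real.sin (q 2) * (Real.cos (q 2 / 2) * h (base q)) ≠ 0 :=
    fun q hq => mul_ne_zero (hs' q hq) (hc' q hq)
  intro a j
  fin_cases a <;> fin_cases j <;> simp only [dualFrame, Fin.reduceFinMk, Fin.isValue,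
    Fin.zero_eta, Fin.mk_one, Matrix.of_apply, Matrix.cons_val]
  all_goals first
    | exact contDiffOn_const
    | exact contDiffOn_const.div hc hc'
    | exact contDiffOn_const.div hs hs'
    | exact ((contDiffOn_coord 3).sin.mul hH).div hc hc'
    | exact ((contDiffOn_coord 3).cos.mul hH).div hc hc'
    | exact (h3 _).neg.div (hs.mul hc) hsc'

theorem smooth_connMat (i : Fin 4) : IsSmoothOn (dom U) (connMat h H i) := by
  intro a j
  fin_cases a <;> fin_cases j <;> simp only [connMat, Fin.reduceFinMk, Fin.isValue,
    Fin.zero_eta, Fin.mk_one, Matrix.of_apply, Matrix.cons_val]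
  all_goals first
    | exact contDiffOn_const
    | exact hA.contDiffOn_rotF i
    | exact (hA.contDiffOn_rotF i).neg
    | exact hA.contDiffOn_phiF i
    | exact (hA.contDiffOn_phiF i).neg
    | exact hA.contDiffOn_mixF _ i
    | exact (hA.contDiffOn_mixF _ i).neg

/-! ### Cartan's structure equations for the explicit coframe -/

variable (hp : p ∈ dom U)
include hp

theorem dualFrame_mul : dualFrame h H p * coframe h H p = 1 := by
  have h1 := (cos_half_pos hp).ne'
  have h2 := (hA.h_pos _ hp.1).ne'
  have h3 := (sin_pos' hp).ne'
  rw [mul_eq_one_comm]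
  ext a b
  fin_cases a <;> fin_cases b <;>
    simp [Matrix.mul_apply, Fin.sum_univ_four, dualFrame, coframe, dcoord, theta3, theta4] <;>
    field_simp <;> ring

theorem extD1_coframe (a i j : Fin 4) : extD1 (fun q => coframe h H q a) p i j =
    ![-(1 / 2) * Real.sin (p 2 / 2) * h (base p) * wedge (dcoord 2) (dcoord 0) i j
        + Real.cos (p 2 / 2) * h (base p) *
          (dX (logF h) (base p) * wedge (dcoord 0) (dcoord 0) i j
            + dY (logF h) (base p) * wedge (dcoord 1) (dcoord 0) i j),
      -(1 / 2) * Real.sin (p 2 / 2) * h (base p) * wedge (dcoord 2) (dcoord 1) i j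
        + Real.cos (p 2 / 2) * h (base p) *
          (dX (logF h) (base p) * wedge (dcoord 0) (dcoord 1) i j
            + dY (logF h) (base p) * wedge (dcoord 1) (dcoord 1) i j),
      -wedge (phiF H p) (theta4 H p) i j
        - Real.sin (p 2) * (1 / 2 * h (base p) ^ 2) * wedge (dcoord 0) (dcoord 1) i j,
      wedge (phiF H p) (theta3 H p) i j] a := by
  fin_cases a
  · exact hA.extD1_baseCoframe hp 0 i j
  · exact hA.extD1_baseCoframe hp 1 i j
  · exact hA.extD1_theta3 hp i j
  · exact hA.extD1_theta4 hp i j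

/-- First structure equation. Together with `connMat_skew` it identifies `connMat` as the
Levi-Civita connection of the coframe. -/
theorem structure_eq (a i j : Fin 4) : extD1 (fun q => coframe h H q a) p i j
    + ∑ b, (connMat h H i p a b * coframe h H p b j
      - connMat h H j p a b * coframe h H p b i) = 0 := by
  have h5 := Real.sin_sq_add_cos_sq (p 2 / 2)
  have h6 := cos_eq_half (p 2)
  have h7 := sin_eq_half (p 2)
  have h8 := Real.sin_sq_add_cos_sq (p 2)
  rw [hA.extD1_coframe hp]
  fin_cases a <;> simp only [coframe, connMat, Fin.reduceFinMk, Fin.isValue, Fin.zero_eta,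
    Fin.mk_one, Matrix.of_apply, Matrix.cons_val, Fin.sum_univ_four]
  · simp only [wedge, Matrix.of_apply, rotF, mixF, theta3_eq, theta4_eq, alphaF, betaF, starF]
    rw [h6, h7]
    linear_combination (-(1 / 2) * Real.cos (p 2 / 2) * h (base p)
      * (tauF H p i * dcoord 1 j - tauF H p j * dcoord 1 i)
      - 1 / 2 * h (base p) * H (base p) * Real.cos (p 3) * Real.sin (p 2 / 2)
      * (dcoord 0 i * dcoord 1 j - dcoord 0 j * dcoord 1 i)) * h5
  · simp only [wedge, Matrix.of_apply, rotF, mixF, theta3_eq, theta4_eq, alphaF, betaF, starF]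
    rw [h6, h7]
    linear_combination (1 / 2 * Real.cos (p 2 / 2) * h (base p)
      * (tauF H p i * dcoord 0 j - tauF H p j * dcoord 0 i)
      + 1 / 2 * h (base p) * H (base p) * Real.sin (p 3) * Real.sin (p 2 / 2)
      * (dcoord 0 i * dcoord 1 j - dcoord 0 j * dcoord 1 i)) * h5
  · simp only [wedge, Matrix.of_apply, mixF, h7]
    ring
  · simp only [wedge, Matrix.of_apply, mixF]
    ring

/-- Second structure equation, checked entry by entry. Only the base entries `(0,1)` and `(1,0)`
involve `A`; the remaining ones follow from the structure equations and half-angle identities. -/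
theorem curvForm_eq (i j : Fin 4) : curvForm (connMat h H) i j p
    = modelCurv (baseCurv h H p) (fun a => coframe h H p a i) (fun a => coframe h H p a j) := by
  have h5 := Real.sin_sq_add_cos_sq (p 2 / 2)
  have h6 := cos_eq_half (p 2)
  have h7 := sin_eq_half (p 2)
  -- The definition of `A` cleared of its denominator, so that the base entries become linear in it.
  have hK : baseCurv h H p * (Real.cos (p 2 / 2) ^ 2 * h (base p) ^ 2)
      = 1 / 2 * H (base p) ^ 2 - Real.sin (p 2 / 2) ^ 2 * h (base p) ^ 2
        - lap (logF h) (base p) := by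
    have h1 := (cos_half_pos hp).ne'
    have h2 := (hA.h_pos _ hp.1).ne'
    rw [baseCurv]
    field_simp
  ext a b
  rw [curvForm_apply, extD1_connMat, hA.extD1_mixF hp, hA.extD1_mixF hp, hA.extD1_rotF hp,
    hA.extD1_phiF hp]
  fin_cases a <;> fin_cases b <;>
    simp only [connMat, modelCurv, coframe, frameKahler, wedge, Fin.reduceFinMk, Fin.isValue,
      Fin.zero_eta, Fin.mk_one, Matrix.of_apply, Matrix.cons_val, Fin.sum_univ_four,
      Matrix.add_apply, Matrix.smul_apply, smul_eq_mul, Matrix.mulVec, dotProduct]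
  all_goals simp only [rotF, mixF, phiF, theta3_eq, theta4_eq, alphaF, betaF, starF]
  all_goals rw [h6, h7]
  all_goals first
    | ring1
    | linear_combination -(dcoord 0 i * dcoord 1 j - dcoord 0 j * dcoord 1 i) * hK
    | linear_combination (dcoord 0 i * dcoord 1 j - dcoord 0 j * dcoord 1 i) * hK
    | linear_combination (1 / 4 * h (base p) * (Real.cos (p 2 / 2) * H (base p) * Real.sin (p 3)
        * (dcoord 0 i * dcoord 1 j - dcoord 0 j * dcoord 1 i)
        - Real.sin (p 2 / 2) * (tauF H p i * dcoord 0 j - tauF H p j * dcoord 0 i))) * h5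
    | linear_combination (-1 / 4 * h (base p) * (Real.cos (p 2 / 2) * H (base p) * Real.sin (p 3)
        * (dcoord 0 i * dcoord 1 j - dcoord 0 j * dcoord 1 i)
        - Real.sin (p 2 / 2) * (tauF H p i * dcoord 0 j - tauF H p j * dcoord 0 i))) * h5
    | linear_combination (1 / 4 * h (base p) * (Real.cos (p 2 / 2) * H (base p) * Real.cos (p 3)
        * (dcoord 0 i * dcoord 1 j - dcoord 0 j * dcoord 1 i)
        - Real.sin (p 2 / 2) * (tauF H p i * dcoord 1 j - tauF H p j * dcoord 1 i))) * h5
    | linear_combination (-1 / 4 * h (base p) * (Real.cos (p 2 / 2) * H (base p) * Real.cos (p 3)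
        * (dcoord 0 i * dcoord 1 j - dcoord 0 j * dcoord 1 i)
        - Real.sin (p 2 / 2) * (tauF H p i * dcoord 1 j - tauF H p j * dcoord 1 i))) * h5

end Admissible

/-! ## Almost complex structures with constant components in a moving frame -/

/-- The endomorphism field with constant matrix `K` in the frame. -/
def frameEnd (E F : Tens) (K : Matrix (Fin 4) (Fin 4) ℝ) : Tens := fun p => F p * K * E p

namespace IsMovingFrame

variable {M : Set Pt} {g E F : Tens} {W : Fin 4 → Tens} {p : Pt}
  {K : Matrix (Fin 4) (Fin 4) ℝ}

theorem ev2_eq (hf : IsMovingFrame M g E F W) (hp : p ∈ M) (X Y : Pt) :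
    ev2 (g p) X Y = (E p *ᵥ X) ⬝ᵥ (E p *ᵥ Y) := by
  have h1 : ev2 (g p) X Y = X ⬝ᵥ g p *ᵥ Y := by
    simp only [ev2, dotProduct, Matrix.mulVec, Finset.mul_sum]
    exact Finset.sum_congr rfl fun i _ => Finset.sum_congr rfl fun j _ => by ring
  rw [h1, hf.metric p hp, ← Matrix.mulVec_mulVec, Matrix.dotProduct_mulVec,
    Matrix.vecMul_transpose]

theorem mul_frameEnd (hf : IsMovingFrame M g E F W) (hp : p ∈ M) :
    E p * frameEnd E F K p = K * E p := by
  rw [frameEnd, ← Matrix.mul_assoc, ← Matrix.mul_assoc, hf.inv' hp, Matrix.one_mul]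

theorem mulVec_frameEnd (hf : IsMovingFrame M g E F W) (hp : p ∈ M) (X : Pt) :
    E p *ᵥ (frameEnd E F K p *ᵥ X) = K *ᵥ (E p *ᵥ X) := by
  rw [Matrix.mulVec_mulVec, hf.mul_frameEnd hp, Matrix.mulVec_mulVec]

theorem mulVec_injective (hf : IsMovingFrame M g E F W) (hp : p ∈ M) {X Y : Pt}
    (h : E p *ᵥ X = E p *ᵥ Y) : X = Y := by
  have := congrArg (F p *ᵥ ·) h
  simpa [Matrix.mulVec_mulVec, hf.inv p hp] using this

theorem mulVec_dual (hf : IsMovingFrame M g E F W) (hp : p ∈ M) (x : Pt) :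
    E p *ᵥ (F p *ᵥ x) = x := by
  rw [Matrix.mulVec_mulVec, hf.inv' hp, Matrix.one_mulVec]

theorem smooth_frameEnd (hf : IsMovingFrame M g E F W) (K : Matrix (Fin 4) (Fin 4) ℝ) :
    IsSmoothOn M (frameEnd E F K) :=
  (hf.smoothF.mul (isSmoothOn_const M K)).mul hf.smoothE

theorem kahlerForm_eq (hf : IsMovingFrame M g E F W) (hp : p ∈ M) :
    kahlerForm g (frameEnd E F K) p = (E p)ᵀ * Kᵀ * E p := by
  rw [kahlerForm, hf.metric p hp, ← Matrix.mul_assoc, ← Matrix.transpose_mul,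
    hf.mul_frameEnd hp, Matrix.transpose_mul]

/-- Since `K` is constant, differentiating `E J = K E` shows that `∇ᵢJ` has matrix `[Wᵢ, K]` in the
frame; the Christoffel terms convert it back to a partial derivative. -/
theorem mul_pdMat_frameEnd (hf : IsMovingFrame M g E F W) (hp : p ∈ M) (i : Fin 4) :
    E p * pdMat i (frameEnd E F K) p
      = E p * (frameEnd E F K p * chrMat g i p - chrMat g i p * frameEnd E F K p)
        + (W i p * K - K * W i p) * E p := by
  have hE := hf.smoothE.diffTens hf.isOpen hp
  have hJ := (hf.smooth_frameEnd K).diffTens hf.isOpen hp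
  have h1 := pdMat_congr hf.isOpen hp (fun q hq => hf.mul_frameEnd (K := K) hq) i
  rw [pdMat_mul hE hJ, pdMat_mul (DiffTens.const K p) hE, pdMat_const] at h1
  have h2 := hf.mul_chrMat hp i
  have h3 := hf.mul_frameEnd (K := K) hp
  have h4 : pdMat i E p = E p * chrMat g i p - W i p * E p := by rw [h2]; noncomm_ring
  rw [h4] at h1
  calc E p * pdMat i (frameEnd E F K) p
      = K * (E p * chrMat g i p - W i p * E p)
        - (E p * chrMat g i p - W i p * E p) * frameEnd E F K p := by
          rw [eq_sub_iff_add_eq, add_comm, h1]; noncomm_ring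
    _ = (K * E p) * chrMat g i p - E p * chrMat g i p * frameEnd E F K p
        - K * W i p * E p + W i p * (E p * frameEnd E F K p) := by noncomm_ring
    _ = (E p * frameEnd E F K p) * chrMat g i p - E p * chrMat g i p * frameEnd E F K p
        - K * W i p * E p + W i p * (K * E p) := by rw [h3]
    _ = _ := by noncomm_ring

theorem pdMat_frameEnd (hf : IsMovingFrame M g E F W) (hp : p ∈ M) (i : Fin 4) :
    pdMat i (frameEnd E F K) p
      = frameEnd E F K p * chrMat g i p - chrMat g i p * frameEnd E F K p
        + F p * ((W i p * K - K * W i p) * E p) := by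
  have h := congrArg (F p * ·) (hf.mul_pdMat_frameEnd (K := K) hp i)
  simpa only [Matrix.mul_add, ← Matrix.mul_assoc, hf.inv p hp, Matrix.one_mul] using h

/-- The Nijenhuis tensor is the antisymmetrisation of the covariant derivative. -/
theorem nijenhuis_eq (hf : IsMovingFrame M g E F W) (hp : p ∈ M) {D : Fin 4 → Tens}
    {J : Tens} (hD : ∀ i, pdMat i J p = J p * chrMat g i p - chrMat g i p * J p + D i p)
    (k i j : Fin 4) :
    nijenhuis J k i j p = ∑ l, J p l i * D l p k j - ∑ l, J p l j * D l p k i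
      - ((J p * D i p) k j - (J p * D j p) k i) := by
  have hsym : ∀ a b c, chrMat g a p c b = chrMat g b p c a := fun a b c => hf.chr_symm hp a b c
  -- The next three identities are the cancellations of the Christoffel terms, all due to their
  -- symmetry in the lower indices.
  have h1 : ∀ i j, ∑ l, J p l i * (J p * chrMat g l p) k j
      = ∑ l, J p k l * (chrMat g j p * J p) l i := fun i j => by
    simp only [Matrix.mul_apply, Finset.mul_sum]
    rw [Finset.sum_comm]
    refine Finset.sum_congr rfl fun l _ => Finset.sum_congr rfl fun m _ => ?_
    rw [hsym m j l]; ring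
  have h2 : ∑ l, J p l i * (chrMat g l p * J p) k j
      = ∑ l, J p l j * (chrMat g l p * J p) k i := by
    simp only [Matrix.mul_apply, Finset.mul_sum]
    rw [Finset.sum_comm]
    refine Finset.sum_congr rfl fun l _ => Finset.sum_congr rfl fun m _ => ?_
    rw [hsym m l k]; ring
  have h3 : ∑ l, J p k l * (J p * chrMat g i p) l j
      = ∑ l, J p k l * (J p * chrMat g j p) l i := by
    refine Finset.sum_congr rfl fun l _ => ?_
    simp only [Matrix.mul_apply]
    congr 1
    exact Finset.sum_congr rfl fun m _ => by rw [hsym i j m]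
  have hpd : ∀ l a b, pd l (fun q => J q a b) p
      = (J p * chrMat g l p) a b - (chrMat g l p * J p) a b + D l p a b := fun l a b => by
    have := congrFun (congrFun (hD l) a) b
    simpa only [pdMat, Matrix.of_apply, Matrix.add_apply, Matrix.sub_apply] using this
  have h4 := h1 i j
  have h5 := h1 j i
  simp only [nijenhuis, hpd, Matrix.mul_apply (M := J p) (N := D _ p), mul_add, mul_sub,
    Finset.sum_add_distrib, Finset.sum_sub_distrib]
  linear_combination h4 - h5 - h2 - h3

/-- Here `V c` is the derivative of `J` along the `c`-th frame vector. Integrability becomes the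
purely algebraic condition `hint` on constant vectors. -/
theorem nijenhuis_frameEnd (hf : IsMovingFrame M g E F W) (hp : p ∈ M)
    {V : Fin 4 → Matrix (Fin 4) (Fin 4) ℝ}
    (hV : ∀ i, W i p * K - K * W i p = ∑ c, E p c i • V c)
    (hint : ∀ x y : Fin 4 → ℝ, (∑ c, (K *ᵥ x) c • V c) *ᵥ y - (∑ c, (K *ᵥ y) c • V c) *ᵥ x
      - K *ᵥ ((∑ c, x c • V c) *ᵥ y - (∑ c, y c • V c) *ᵥ x) = 0) (k i j : Fin 4) :
    nijenhuis (frameEnd E F K) k i j p = 0 := by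
  have hD : ∀ i, pdMat i (frameEnd E F K) p = frameEnd E F K p * chrMat g i p
      - chrMat g i p * frameEnd E F K p + F p * ((∑ c, E p c i • V c) * E p) := fun i => by
    rw [hf.pdMat_frameEnd hp, hV]
  rw [hf.nijenhuis_eq hp (D := fun i p => F p * ((∑ c, E p c i • V c) * E p)) hD]
  have hc : ∀ (B : Matrix (Fin 4) (Fin 4) ℝ) (j : Fin 4),
      (F p * (B * E p)) k j = (F p *ᵥ (B *ᵥ fun a => E p a j)) k := fun B j => by
    simp only [Matrix.mul_apply, Matrix.mulVec, dotProduct]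
  have h1 : ∀ i j, ∑ l, frameEnd E F K p l i * (F p * ((∑ c, E p c l • V c) * E p)) k j
      = (F p *ᵥ ((∑ c, (K *ᵥ fun a => E p a i) c • V c) *ᵥ fun a => E p a j)) k := fun i j => by
    have h2 : ∑ c, (K *ᵥ fun a => E p a i) c • V c
        = ∑ l, frameEnd E F K p l i • ∑ c, E p c l • V c := by
      simp only [Finset.smul_sum, smul_smul]
      rw [Finset.sum_comm]
      refine Finset.sum_congr rfl fun c _ => ?_
      rw [← Finset.sum_smul]
      congr 1
      have := congrFun (congrFun (hf.mul_frameEnd (K := K) hp) c) i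
      rw [Matrix.mul_apply, Matrix.mul_apply] at this
      rw [Matrix.mulVec, dotProduct, ← this]
      exact Finset.sum_congr rfl fun _ _ => mul_comm _ _
    rw [h2, ← hc, Finset.sum_mul, Finset.mul_sum, Matrix.sum_apply]
    simp only [smul_mul_assoc, mul_smul_comm, Matrix.smul_apply, smul_eq_mul]
  have h3 : ∀ i j, (frameEnd E F K p * (F p * ((∑ c, E p c i • V c) * E p))) k j
      = (F p *ᵥ (K *ᵥ ((∑ c, E p c i • V c) *ᵥ fun a => E p a j))) k := fun i j => by
    rw [Matrix.mulVec_mulVec _ K, ← hc, frameEnd]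
    refine congrFun (congrFun ?_ k) j
    calc F p * K * E p * (F p * ((∑ c, E p c i • V c) * E p))
        = F p * (K * ((E p * F p) * ((∑ c, E p c i • V c) * E p))) := by noncomm_ring
      _ = _ := by rw [hf.inv' hp]; noncomm_ring
  rw [h1, h1, h3, h3]
  have := congrFun (congrArg (F p *ᵥ ·) (hint (fun a => E p a i) fun a => E p a j)) k
  simpa only [Matrix.mulVec_sub, Pi.sub_apply, Matrix.mulVec_zero, Pi.zero_apply] using this

/-- For a torsion-free connection `dΩ` is the cyclic sum of `∇Ω`, and `∇Ω` is given by the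
commutators `[W, K]`. -/
theorem extD2_frameEnd (hf : IsMovingFrame M g E F W) (hp : p ∈ M) (hK : Kᵀ = -K)
    {V : Fin 4 → Matrix (Fin 4) (Fin 4) ℝ}
    (hV : ∀ i, W i p * K - K * W i p = ∑ c, E p c i • V c) (i j k : Fin 4) :
    extD2 (kahlerForm g (frameEnd E F K)) p i j k
      = -((fun a => E p a j) ⬝ᵥ (∑ c, E p c i • V c) *ᵥ (fun a => E p a k)
        - (fun a => E p a i) ⬝ᵥ (∑ c, E p c j • V c) *ᵥ (fun a => E p a k)
        + (fun a => E p a i) ⬝ᵥ (∑ c, E p c k • V c) *ᵥ (fun a => E p a j)) := by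
  have hE := hf.smoothE.diffTens hf.isOpen hp
  have hsym : ∀ a b c, chrMat g a p c b = chrMat g b p c a := fun a b c => hf.chr_symm hp a b c
  set w : Matrix (Fin 4) (Fin 4) ℝ := (E p)ᵀ * Kᵀ * E p with hw
  have hwt : ∀ a b, w a b = -w b a := fun a b => by
    have : wᵀ = -w := by
      rw [hw, Matrix.transpose_mul, Matrix.transpose_mul, Matrix.transpose_transpose,
        Matrix.transpose_transpose, hK]
      noncomm_ring
    exact congrFun (congrFun this b) a
  have hpd : ∀ i, pdMat i (kahlerForm g (frameEnd E F K)) p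
      = (chrMat g i p)ᵀ * w + w * chrMat g i p - (E p)ᵀ * ((∑ c, E p c i • V c) * E p) := by
    intro i
    rw [pdMat_congr hf.isOpen hp (fun q hq => hf.kahlerForm_eq hq),
      pdMat_mul (hE.transpose.mul (.const _ p)) hE, pdMat_mul hE.transpose (.const _ p),
      pdMat_const, pdMat_transpose, ← hV]
    have h4 : pdMat i E p = E p * chrMat g i p - W i p * E p := by
      rw [hf.mul_chrMat hp i]; noncomm_ring
    rw [h4, Matrix.transpose_sub, Matrix.transpose_mul, Matrix.transpose_mul, hf.skew i p hp,
      hw, hK]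
    noncomm_ring
  have hV' : ∀ i j k, ((E p)ᵀ * ((∑ c, E p c i • V c) * E p)) j k
      = (fun a => E p a j) ⬝ᵥ (∑ c, E p c i • V c) *ᵥ (fun a => E p a k) := fun i j k => by
    simp only [Matrix.mul_apply, Matrix.mulVec, dotProduct, Matrix.transpose_apply]
  have key : ∀ i j k, pd i (fun q => kahlerForm g (frameEnd E F K) q j k) p
      = ∑ m, chrMat g i p m j * w m k + ∑ m, w j m * chrMat g i p m k
        - (fun a => E p a j) ⬝ᵥ (∑ c, E p c i • V c) *ᵥ (fun a => E p a k) := fun i j k => by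
    have := congrFun (congrFun (hpd i) j) k
    rw [Matrix.sub_apply, Matrix.add_apply, hV', Matrix.mul_apply, Matrix.mul_apply] at this
    exact this
  -- The six Christoffel terms cancel in pairs, by their symmetry and the skewness of `w`.
  have e1 : ∑ m, chrMat g i p m j * w m k = ∑ m, chrMat g j p m i * w m k :=
    Finset.sum_congr rfl fun m _ => by rw [hsym i j m]
  have e2 : ∑ m, w j m * chrMat g i p m k = -∑ m, chrMat g k p m i * w m j := by
    rw [← Finset.sum_neg_distrib]
    exact Finset.sum_congr rfl fun m _ => by rw [hsym i k m, hwt j m]; ring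
  have e3 : ∑ m, w i m * chrMat g j p m k = ∑ m, w i m * chrMat g k p m j :=
    Finset.sum_congr rfl fun m _ => by rw [hsym j k m]
  rw [extD2, key, key, key, e1, e2, e3]
  ring

theorem isHermitian (hf : IsMovingFrame M g E F W) (hsq : K * K = -1) (hK : Kᵀ = -K)
    (hint : ∀ p ∈ M, ∀ i j k, nijenhuis (frameEnd E F K) k i j p = 0) :
    IsHermitian M g (frameEnd E F K) where
  riemannian := hf.isRiemannian
  smooth := hf.smooth_frameEnd K
  sq p hp := by
    calc frameEnd E F K p * frameEnd E F K p = F p * K * (E p * frameEnd E F K p) := by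
          rw [frameEnd]; noncomm_ring
      _ = F p * (K * K) * E p := by rw [hf.mul_frameEnd hp]; noncomm_ring
      _ = -(F p * E p) := by rw [hsq]; noncomm_ring
      _ = -1 := by rw [hf.inv p hp]
  orthogonal p hp X Y := by
    rw [hf.ev2_eq hp, hf.ev2_eq hp, hf.mulVec_frameEnd hp, hf.mulVec_frameEnd hp,
      Matrix.dotProduct_mulVec, ← Matrix.mulVec_transpose, Matrix.mulVec_mulVec, hK,
      Matrix.neg_mul, hsq, neg_neg, Matrix.one_mulVec]
  integrable := hint

/-! ### Curvature, Ricci tensor, norm and codifferential read in the frame -/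

/-- The columns of `E` are the frame components of the coordinate vectors, so a bilinear formula
valid on them extends to all vectors. -/
theorem curv_eq (hf : IsMovingFrame M g E F W) (hp : p ∈ M)
    {R : (Fin 4 → ℝ) →ₗ[ℝ] (Fin 4 → ℝ) →ₗ[ℝ] Matrix (Fin 4) (Fin 4) ℝ}
    (hR : ∀ i j, curvForm W i j p = R (fun a => E p a i) (fun a => E p a j)) (X Y Z : Pt) :
    E p *ᵥ curv g p X Y Z = R (E p *ᵥ X) (E p *ᵥ Y) *ᵥ (E p *ᵥ Z) := by
  have hcol : ∀ X : Pt, E p *ᵥ X = ∑ i, X i • fun a => E p a i := fun X => by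
    ext a
    simp [Matrix.mulVec, dotProduct, Finset.sum_apply, mul_comm]
  have h1 : curv g p X Y Z = F p *ᵥ (R (E p *ᵥ X) (E p *ᵥ Y) *ᵥ (E p *ᵥ Z)) := by
    rw [Matrix.mulVec_mulVec, Matrix.mulVec_mulVec, hcol X, hcol Y]
    simp only [map_sum, map_smul, LinearMap.sum_apply, LinearMap.smul_apply, ← hR]
    ext l
    simp only [curv, hf.riem_eq hp, Finset.smul_sum, smul_smul, Finset.mul_sum,
      Finset.sum_mul, Matrix.mulVec, dotProduct, Matrix.sum_apply, Matrix.smul_apply,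
      smul_eq_mul, mul_smul_comm, smul_mul_assoc, Matrix.mul_assoc]
    refine Finset.sum_congr rfl fun k _ => ?_
    rw [Finset.sum_comm]
    exact Finset.sum_congr rfl fun i _ => Finset.sum_congr rfl fun j _ => by ring
  rw [h1, hf.mulVec_dual hp]

theorem ricci_apply (hf : IsMovingFrame M g E F W) (hp : p ∈ M)
    {R : (Fin 4 → ℝ) →ₗ[ℝ] (Fin 4 → ℝ) →ₗ[ℝ] Matrix (Fin 4) (Fin 4) ℝ}
    (hR : ∀ i j, curvForm W i j p = R (fun a => E p a i) (fun a => E p a j)) (Y Z : Pt) :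
    ev2 (ricci g p) Y Z
      = ∑ a, (R (Pi.single a 1) (E p *ᵥ Y) *ᵥ (E p *ᵥ Z)) a := by
  have h1 : ∀ Y Z, ev2 (ricci g p) Y Z = ∑ i, curv g p (Pi.single i 1) Y Z i := by
    intro Y Z
    have : ∀ i, curv g p (Pi.single i 1) Y Z i
        = ∑ k, ∑ j, riem g i k i j p * Y j * Z k := fun i => by
      simp [curv, Pi.single_apply]
    simp only [ev2, ricci, Matrix.of_apply, this, Finset.sum_mul]
    rw [Finset.sum_congr rfl fun j _ => Finset.sum_comm, Finset.sum_comm]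
    exact Finset.sum_congr rfl fun i _ => Finset.sum_comm
  have h2 : ∀ i, curv g p (Pi.single i 1) Y Z i
      = ∑ a, ∑ c, F p i a * E p c i
        * (R (Pi.single c 1) (E p *ᵥ Y) *ᵥ (E p *ᵥ Z)) a := fun i => by
    have h3 : curv g p (Pi.single i 1) Y Z
        = F p *ᵥ (R (E p *ᵥ Pi.single i 1) (E p *ᵥ Y) *ᵥ (E p *ᵥ Z)) := by
      rw [← hf.curv_eq hp hR, Matrix.mulVec_mulVec, hf.inv p hp, Matrix.one_mulVec]
    have h4 : E p *ᵥ Pi.single i 1 = ∑ c, E p c i • (Pi.single c 1 : Fin 4 → ℝ) := by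
      ext a
      simp [Finset.sum_apply, Pi.single_apply]
    rw [h3, h4, Matrix.mulVec, dotProduct]
    refine Finset.sum_congr rfl fun a _ => ?_
    simp only [map_sum, map_smul, LinearMap.sum_apply, LinearMap.smul_apply, Matrix.sum_mulVec,
      Matrix.smul_mulVec, Finset.sum_apply, Pi.smul_apply, smul_eq_mul, Finset.mul_sum]
    exact Finset.sum_congr rfl fun c _ => by ring
  have h5 : ∀ a c, ∑ i, F p i a * E p c i = if c = a then 1 else 0 := fun a c => by
    have := congrFun (congrFun (hf.inv' hp) c) a
    rw [Matrix.mul_apply, Matrix.one_apply] at this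
    rw [← this]
    exact Finset.sum_congr rfl fun _ _ => mul_comm _ _
  rw [h1, Finset.sum_congr rfl fun i _ => h2 i, Finset.sum_comm]
  refine Finset.sum_congr rfl fun a _ => ?_
  rw [Finset.sum_comm]
  simp only [← Finset.sum_mul, h5]
  simp

theorem normSq_smul (hf : IsMovingFrame M g E F W) (hp : p ∈ M) (f : Pt → ℝ) (a : Fin 4) :
    normSq g (fun q i => f q * E q a i) p = f p ^ 2 := by
  have h1 : ∀ c, ∑ i, F p i c * E p a i = if a = c then 1 else 0 := fun c => by
    have := congrFun (congrFun (hf.inv' hp) a) c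
    rw [Matrix.mul_apply, Matrix.one_apply] at this
    rw [← this]
    exact Finset.sum_congr rfl fun _ _ => mul_comm _ _
  have h2 : normSq g (fun q i => f q * E q a i) p
      = f p ^ 2 * ∑ c, (∑ i, F p i c * E p a i) * ∑ j, F p j c * E p a j := by
    simp only [normSq, hf.metric_inv hp, Matrix.mul_apply, Matrix.transpose_apply,
      Finset.sum_mul, Finset.mul_sum]
    rw [Finset.sum_congr rfl fun i _ => Finset.sum_comm, Finset.sum_comm]
    exact Finset.sum_congr rfl fun _ _ => Finset.sum_congr rfl fun _ _ =>
      Finset.sum_congr rfl fun _ _ => by ring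
  rw [h2]
  simp [h1]

/-- In the frame `∇Eᵃ = -∑ Wᵃ_c Eᶜ`; tracing `∇(f Eᵃ)` gives the derivative of `f` along the `a`-th
frame vector and the trace of the connection entries. -/
theorem codiff_smul (hf : IsMovingFrame M g E F W) (hp : p ∈ M) {f : Pt → ℝ} {v : Fin 4 → ℝ}
    (hfv : HasGrad f v p) (a : Fin 4) :
    codiff g (fun q i => f q * E q a i) p
      = -∑ i, F p i a * v i + f p * ∑ c, ∑ i, F p i c * W i p a c := by
  have hE := hf.smoothE.diffTens hf.isOpen hp
  have h1 : ∀ b c, ∑ j, F p j c * E p b j = if b = c then 1 else 0 := fun b c => by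
    have := congrFun (congrFun (hf.inv' hp) b) c
    rw [Matrix.mul_apply, Matrix.one_apply] at this
    rw [← this]
    exact Finset.sum_congr rfl fun _ _ => mul_comm _ _
  have h2 : ∀ i j, pd i (fun q => f q * E q a j) p - ∑ k, christoffel g k i j p * (f p * E p a k)
      = v i * E p a j - f p * ∑ b, W i p a b * E p b j := fun i j => by
    have h3 := congrFun (congrFun (hf.mul_chrMat hp i) a) j
    rw [Matrix.mul_apply, Matrix.add_apply, Matrix.mul_apply] at h3
    have h4 : ∑ k, christoffel g k i j p * (f p * E p a k)
        = f p * ∑ k, E p a k * chrMat g i p k j := by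
      rw [Finset.mul_sum]
      exact Finset.sum_congr rfl fun k _ => by simp only [chrMat, Matrix.of_apply]; ring
    rw [pd_mul hfv.1 (hE a j), hfv.2, h4, h3]
    simp only [pdMat, Matrix.of_apply]
    ring
  have h5 : ∀ i c, ∑ j, F p j c * (v i * E p a j - f p * ∑ b, W i p a b * E p b j)
      = v i * (if a = c then 1 else 0) - f p * W i p a c := fun i c => by
    have : ∑ j, F p j c * (v i * E p a j - f p * ∑ b, W i p a b * E p b j)
        = v i * ∑ j, F p j c * E p a j
          - f p * ∑ b, W i p a b * ∑ j, F p j c * E p b j := by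
      simp only [Finset.mul_sum, mul_sub, Finset.sum_sub_distrib]
      rw [Finset.sum_comm (f := fun b j => f p * (W i p a b * (F p j c * E p b j)))]
      congr 1
      · exact Finset.sum_congr rfl fun _ _ => by ring
      · exact Finset.sum_congr rfl fun _ _ => Finset.sum_congr rfl fun _ _ => by ring
    rw [this, h1]
    simp [h1]
  have h6 : codiff g (fun q i => f q * E q a i) p = -∑ c, ∑ i, F p i c *
      ∑ j, F p j c * (v i * E p a j - f p * ∑ b, W i p a b * E p b j) := by
    simp only [codiff, h2, hf.metric_inv hp, Matrix.mul_apply, Matrix.transpose_apply]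
    rw [Finset.sum_comm (f := fun c i => F p i c * _)]
    congr 1
    refine Finset.sum_congr rfl fun i _ => ?_
    simp only [Finset.sum_mul]
    rw [Finset.sum_comm]
    refine Finset.sum_congr rfl fun _ _ => ?_
    rw [Finset.mul_sum]
    exact Finset.sum_congr rfl fun _ _ => mul_assoc _ _ _
  rw [h6]
  simp_rw [h5]
  simp only [mul_sub, Finset.sum_sub_distrib, Finset.mul_sum]
  rw [neg_sub, sub_eq_neg_add]
  congr 1
  · rw [Finset.sum_comm]
    simp
  · exact Finset.sum_congr rfl fun _ _ => Finset.sum_congr rfl fun _ _ => by ring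

end IsMovingFrame

/-! ## The structures on the explicit surface -/

/-- `modelCurv` as a bilinear map. -/
def modelCurvL (A : ℝ) : (Fin 4 → ℝ) →ₗ[ℝ] (Fin 4 → ℝ) →ₗ[ℝ] Matrix (Fin 4) (Fin 4) ℝ :=
  LinearMap.mk₂ ℝ (modelCurv A)
    (fun x x' y => by
      ext a b
      simp only [modelCurv, wedge, Matrix.mulVec_add, add_dotProduct, Matrix.add_apply,
        Matrix.smul_apply, Matrix.of_apply, Pi.add_apply, smul_eq_mul]
      ring)
    (fun c x y => by
      ext a b
      simp only [modelCurv, wedge, Matrix.mulVec_smul, smul_dotProduct, Matrix.add_apply,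
        Matrix.smul_apply, Matrix.of_apply, Pi.smul_apply, smul_eq_mul]
      ring)
    (fun x y y' => by
      ext a b
      simp only [modelCurv, wedge, Matrix.mulVec_add, dotProduct_add, Matrix.add_apply,
        Matrix.smul_apply, Matrix.of_apply, Pi.add_apply, smul_eq_mul]
      ring)
    (fun c x y => by
      ext a b
      simp only [modelCurv, wedge, Matrix.mulVec_smul, dotProduct_smul, Matrix.add_apply,
        Matrix.smul_apply, Matrix.of_apply, Pi.smul_apply, smul_eq_mul]
      ring)

theorem frameKahler_sq : frameKahler * frameKahler = -1 := by
  ext a b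
  fin_cases a <;> fin_cases b <;> simp [frameKahler, Matrix.mul_apply, Fin.sum_univ_four]

theorem frameHerm_sq : frameHerm * frameHerm = -1 := by
  ext a b
  fin_cases a <;> fin_cases b <;> simp [frameHerm, Matrix.mul_apply, Fin.sum_univ_four]

theorem frameKahler_skew : frameKahlerᵀ = -frameKahler := by
  ext a b
  fin_cases a <;> fin_cases b <;> simp [frameKahler]

theorem frameHerm_skew : frameHermᵀ = -frameHerm := by
  ext a b
  fin_cases a <;> fin_cases b <;> simp [frameHerm]

/-- The covariant derivative of the opposite Hermitian structure along the frame vectors. -/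
def hermDeriv (T : ℝ) : Fin 4 → Matrix (Fin 4) (Fin 4) ℝ :=
  ![T • !![0, 0, -1, 0; 0, 0, 0, 1; 1, 0, 0, 0; 0, -1, 0, 0],
    T • !![0, 0, 0, -1; 0, 0, -1, 0; 0, 1, 0, 0; 1, 0, 0, 0], 0, 0]

theorem frameKahler_mulVec (x : Fin 4 → ℝ) : frameKahler *ᵥ x = ![-x 1, x 0, x 3, -x 2] := by
  ext a
  fin_cases a <;> simp [frameKahler, Matrix.mulVec, dotProduct, Fin.sum_univ_four]

theorem frameHerm_mulVec (x : Fin 4 → ℝ) : frameHerm *ᵥ x = ![-x 1, x 0, -x 3, x 2] := by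
  ext a
  fin_cases a <;> simp [frameHerm, Matrix.mulVec, dotProduct, Fin.sum_univ_four]

/-- The operator commutes with `frameKahler` and is skew, so it lies in `u(2)` and is described by
four numbers. They are kept as variables so that the products below stay short. -/
theorem modelCurv_mulVec (A : ℝ) (x y z : Fin 4 → ℝ) {P Q S N : ℝ}
    (hP : P = A * wedge x y 0 1 + 1 / 2 * wedge x y 3 2)
    (hQ : Q = wedge x y 3 2 + 1 / 2 * wedge x y 0 1)
    (hS : S = 1 / 4 * (wedge x y 3 0 + wedge x y 2 1))
    (hN : N = 1 / 4 * (wedge x y 2 0 - wedge x y 3 1)) :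
    modelCurv A x y *ᵥ z = ![P * z 1 - N * z 2 - S * z 3, -P * z 0 - S * z 2 + N * z 3,
      N * z 0 + S * z 1 - Q * z 3, S * z 0 - N * z 1 + Q * z 2] := by
  subst hP hQ hS hN
  ext a
  fin_cases a <;>
    simp only [modelCurv, frameKahler, wedge, Matrix.mulVec, dotProduct,
      Matrix.add_apply, Matrix.smul_apply, Matrix.of_apply, Fin.sum_univ_four, smul_eq_mul,
      Matrix.cons_val, Fin.reduceFinMk, Fin.isValue, Fin.zero_eta, Fin.mk_one] <;> ring

theorem hermDeriv_mulVec (T : ℝ) (x y : Fin 4 → ℝ) : (∑ c, x c • hermDeriv T c) *ᵥ y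
    = ![T * (-x 0 * y 2 - x 1 * y 3), T * (x 0 * y 3 - x 1 * y 2), T * (x 0 * y 0 + x 1 * y 1),
      T * (-x 0 * y 1 + x 1 * y 0)] := by
  ext a
  fin_cases a <;>
    simp only [hermDeriv, Matrix.mulVec, dotProduct, Matrix.sum_apply, Matrix.smul_apply,
      Matrix.of_apply, Fin.sum_univ_four, smul_eq_mul, Matrix.cons_val, Fin.reduceFinMk,
      Fin.isValue, Fin.zero_eta, Fin.mk_one, Matrix.zero_apply] <;> ring

theorem hermDeriv_integrable (T : ℝ) (x y : Fin 4 → ℝ) :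
    (∑ c, (frameHerm *ᵥ x) c • hermDeriv T c) *ᵥ y
      - (∑ c, (frameHerm *ᵥ y) c • hermDeriv T c) *ᵥ x
      - frameHerm *ᵥ ((∑ c, x c • hermDeriv T c) *ᵥ y - (∑ c, y c • hermDeriv T c) *ᵥ x) = 0 := by
  ext a
  simp only [hermDeriv_mulVec, frameHerm_mulVec]
  fin_cases a <;>
    simp only [Matrix.cons_val, Pi.sub_apply, Pi.zero_apply, Fin.reduceFinMk,
      Fin.isValue, Fin.zero_eta, Fin.mk_one] <;> ring

/-- The space form part contributes `|x|⁴`. The correction sees only the `e₀ ∧ e₁` component of `x ∧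
J̄x`, which is `x₀² + x₁²`, once in the operator and once in the pairing. -/
theorem modelCurv_holomorphic (A : ℝ) (x : Fin 4 → ℝ) :
    (modelCurv A x (frameKahler *ᵥ x) *ᵥ (frameKahler *ᵥ x)) ⬝ᵥ x
      = (x ⬝ᵥ x) ^ 2 + (A - 1) * (x 0 ^ 2 + x 1 ^ 2) ^ 2 := by
  rw [modelCurv_mulVec A _ _ _ rfl rfl rfl rfl]
  simp only [frameKahler_mulVec, wedge, dotProduct, Matrix.of_apply, Fin.sum_univ_four,
    Matrix.cons_val]
  ring

theorem HasGrad.tan {f : Pt → ℝ} {v : Fin 4 → ℝ} {p : Pt} (hf : HasGrad f v p)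
    (hc : Real.cos (f p) ≠ 0) :
    HasGrad (fun q => Real.tan (f q)) (fun i => 1 / Real.cos (f p) ^ 2 * v i) p := by
  have h := (Real.hasDerivAt_tan hc).comp_hasFDerivAt p hf.1.hasFDerivAt
  refine ⟨h.differentiableAt, fun i => ?_⟩
  have h' : fderiv ℝ (fun q => Real.tan (f q)) p = _ := h.fderiv
  have := hf.2 i
  rw [pd] at this
  rw [pd, h', smul_apply, this, smul_eq_mul]

theorem mixF_eq {U : Set (ℝ × ℝ)} {h : ℝ × ℝ → ℝ} {p : Pt} (hp : p ∈ dom U) (k i : Fin 4) :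
    mixF h k p i
      = 1 / 2 * Real.tan (p 2 / 2) * (Real.cos (p 2 / 2) * h (base p) * dcoord k i) := by
  have := (cos_half_pos hp).ne'
  rw [mixF, Real.tan_eq_sin_div_cos]
  field_simp

/-- The connection takes values in `u(2)`, so `J̄` is parallel: both its integrability and the
closedness of `Ω̄` follow with `V = 0`. -/
theorem connMat_frameKahler (h H : ℝ × ℝ → ℝ) (p : Pt) (i : Fin 4) :
    connMat h H i p * frameKahler - frameKahler * connMat h H i p
      = ∑ c, coframe h H p c i • (0 : Fin 4 → Matrix (Fin 4) (Fin 4) ℝ) c := by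
  ext a b
  fin_cases a <;> fin_cases b <;> simp [connMat, frameKahler]

/-- The block-diagonal entries commute with `frameHerm`. Only the mixed entries remain, and by
`mixF_eq` they are `½ tan(z/2)` times the first two covectors of the coframe. -/
theorem connMat_frameHerm {U : Set (ℝ × ℝ)} {h H : ℝ × ℝ → ℝ} {p : Pt} (hp : p ∈ dom U)
    (i : Fin 4) : connMat h H i p * frameHerm - frameHerm * connMat h H i p
      = ∑ c, coframe h H p c i • hermDeriv (Real.tan (p 2 / 2)) c := by
  ext a b
  fin_cases a <;> fin_cases b <;>
    simp only [connMat, frameHerm, Matrix.mul_apply, Fin.sum_univ_four, hermDeriv, coframe,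
      mixF_eq hp, Matrix.sub_apply, Matrix.sum_apply, Matrix.smul_apply, Matrix.of_apply,
      smul_eq_mul, Matrix.cons_val, Matrix.zero_apply, Fin.reduceFinMk, Fin.isValue,
      Fin.zero_eta, Fin.mk_one] <;> ring

/-! ### Kähler and Hermitian structures, Ricci tensor and Lee form -/

namespace Admissible

variable {U : Set (ℝ × ℝ)} {h H : ℝ × ℝ → ℝ} (hA : Admissible U h H)
include hA

theorem isMovingFrame :
    IsMovingFrame (dom U) (metric h H) (coframe h H) (dualFrame h H) (connMat h H) where
  isOpen := isOpen_dom hA.isOpen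
  smoothE := hA.smooth_coframe
  smoothF := hA.smooth_dualFrame
  smoothW := hA.smooth_connMat
  metric p _ := metric_eq h H p
  inv p hp := hA.dualFrame_mul hp
  skew i p _ := connMat_skew h H i p
  torsion p hp a i j := by
    have := hA.structure_eq hp a i j
    rw [Finset.sum_sub_distrib, extD1] at this
    simp only [Matrix.add_apply, Matrix.mul_apply, pdMat, Matrix.of_apply]
    linear_combination this

variable {p : Pt} (hp : p ∈ dom U)
include hp

theorem curvForm_eq' (i j : Fin 4) : curvForm (connMat h H) i j p
    = modelCurvL (baseCurv h H p) (fun a => coframe h H p a i) (fun a => coframe h H p a j) :=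
  hA.curvForm_eq hp i j

theorem curv_frame (X Y Z : Pt) : coframe h H p *ᵥ curv (metric h H) p X Y Z
    = modelCurv (baseCurv h H p) (coframe h H p *ᵥ X) (coframe h H p *ᵥ Y)
      *ᵥ (coframe h H p *ᵥ Z) :=
  hA.isMovingFrame.curv_eq hp (hA.curvForm_eq' hp) X Y Z

theorem curv4_frame (X Y Z Z' : Pt) : curv4 (metric h H) p X Y Z Z'
    = (modelCurv (baseCurv h H p) (coframe h H p *ᵥ X) (coframe h H p *ᵥ Y)
      *ᵥ (coframe h H p *ᵥ Z)) ⬝ᵥ (coframe h H p *ᵥ Z') := by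
  rw [curv4, hA.isMovingFrame.ev2_eq hp, hA.curv_frame hp]

omit hp in
theorem isKahler : IsKahler (dom U) (metric h H)
    (frameEnd (coframe h H) (dualFrame h H) frameKahler) where
  hermitian := hA.isMovingFrame.isHermitian frameKahler_sq frameKahler_skew
    fun p hp i j k => hA.isMovingFrame.nijenhuis_frameEnd hp (V := 0) (connMat_frameKahler h H p)
      (fun x y => by simp only [Pi.zero_apply, smul_zero, Finset.sum_const_zero,
        Matrix.zero_mulVec, sub_self, Matrix.mulVec_zero]) k i j
  closed p hp i j k := by
    rw [hA.isMovingFrame.extD2_frameEnd hp frameKahler_skew (connMat_frameKahler h H p)]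
    simp only [Pi.zero_apply, smul_zero, Finset.sum_const_zero, Matrix.zero_mulVec,
      dotProduct_zero, sub_self, add_zero, neg_zero]

omit hp in
theorem isHermitian : IsHermitian (dom U) (metric h H)
    (frameEnd (coframe h H) (dualFrame h H) frameHerm) :=
  hA.isMovingFrame.isHermitian frameHerm_sq frameHerm_skew fun p hp i j k =>
    hA.isMovingFrame.nijenhuis_frameEnd hp (V := hermDeriv (Real.tan (p 2 / 2)))
      (connMat_frameHerm hp) (hermDeriv_integrable _) k i j

theorem kahlerForm_frameKahler :
    kahlerForm (metric h H) (frameEnd (coframe h H) (dualFrame h H) frameKahler) p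
      = baseForm h p + wedge (theta4 H p) (theta3 H p) := by
  rw [hA.isMovingFrame.kahlerForm_eq hp]
  ext i j
  simp [frameKahler, coframe, Matrix.mul_apply, Fin.sum_univ_four, baseForm, wedge]
  ring

theorem kahlerForm_frameHerm :
    kahlerForm (metric h H) (frameEnd (coframe h H) (dualFrame h H) frameHerm) p
      = baseForm h p + wedge (theta3 H p) (theta4 H p) := by
  rw [hA.isMovingFrame.kahlerForm_eq hp]
  ext i j
  simp [frameHerm, coframe, Matrix.mul_apply, Fin.sum_univ_four, baseForm, wedge]
  ring

omit hp in
theorem areOpposite : AreOpposite (dom U) (metric h H)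
    (frameEnd (coframe h H) (dualFrame h H) frameHerm)
    (frameEnd (coframe h H) (dualFrame h H) frameKahler) := by
  intro p hp
  rw [hA.kahlerForm_frameHerm hp, hA.kahlerForm_frameKahler hp]
  have h1 := cos_half_pos hp
  have h2 := hA.h_pos _ hp.1
  have h3 := sin_pos' hp
  -- The two Pfaffians are `∓ cos²(z/2) h² sin z`, so their product is minus this square.
  have : 0 < (Real.cos (p 2 / 2) ^ 2 * h (base p) ^ 2 * Real.sin (p 2)) ^ 2 := by positivity
  simp [pf, baseForm, wedge, theta3, theta4, dcoord]
  nlinarith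

omit hp in
-- The space form part is Einstein, and the correction contributes a multiple of the metric on the
-- base plane; `J` is orthogonal and preserves that plane.
theorem ricciInvariant : RicciInvariant (dom U) (metric h H)
    (frameEnd (coframe h H) (dualFrame h H) frameHerm) := by
  intro p hp X Y
  rw [hA.isMovingFrame.ricci_apply hp (hA.curvForm_eq' hp),
    hA.isMovingFrame.ricci_apply hp (hA.curvForm_eq' hp), hA.isMovingFrame.mulVec_frameEnd hp,
    hA.isMovingFrame.mulVec_frameEnd hp]
  generalize coframe h H p *ᵥ X = x
  generalize coframe h H p *ᵥ Y = y
  simp only [modelCurvL, LinearMap.mk₂_apply, modelCurv_mulVec _ _ _ _ rfl rfl rfl rfl,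
    frameHerm_mulVec, wedge, Matrix.of_apply, Fin.sum_univ_four, Matrix.cons_val,
    Pi.single_apply, Fin.isValue, Fin.reduceEq, reduceIte]
  ring

omit hp in
theorem isLeeForm : IsLeeForm (dom U) (metric h H)
    (frameEnd (coframe h H) (dualFrame h H) frameHerm) (leeForm H) := by
  intro p hp i j k
  rw [hA.isMovingFrame.extD2_frameEnd hp frameHerm_skew (connMat_frameHerm hp),
    hA.kahlerForm_frameHerm hp]
  have hm := fun i => hermDeriv_mulVec (Real.tan (p 2 / 2)) (fun c => coframe h H p c i)
  simp only [hm]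
  simp only [dotProduct, Fin.sum_univ_four, coframe, baseForm, wedge,
    wedge12, leeForm, Matrix.cons_val, Matrix.of_apply, Matrix.add_apply, Matrix.smul_apply,
    smul_eq_mul]
  ring

end Admissible

/-! ## Conformal rescaling -/

theorem kahlerForm_conformal (g J : Tens) (u : Pt → ℝ) (q : Pt) (j k : Fin 4) :
    kahlerForm (fun q => Real.exp (2 * u q) • g q) J q j k
      = Real.exp (2 * u q) * kahlerForm g J q j k := by
  simp [kahlerForm]

theorem hasGrad_exp_two_mul {u : Pt → ℝ} {p : Pt} (hu : DifferentiableAt ℝ u p) :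
    HasGrad (fun q => Real.exp (2 * u q)) (fun i => Real.exp (2 * u p) * (2 * pd i u p)) p := by
  have h := (hu.hasFDerivAt.const_mul 2).exp
  refine ⟨h.differentiableAt, fun i => ?_⟩
  rw [pd, h.fderiv]
  simp [pd]

theorem extD2_conformal {g J : Tens} {u : Pt → ℝ} {p : Pt} (hu : DifferentiableAt ℝ u p)
    (hw : DiffTens (kahlerForm g J) p) (i j k : Fin 4) :
    extD2 (kahlerForm (fun q => Real.exp (2 * u q) • g q) J) p i j k = Real.exp (2 * u p) *
      (extD2 (kahlerForm g J) p i j k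
        + 2 * wedge12 (fun l => pd l u p) (kahlerForm g J p) i j k) := by
  have hx := hasGrad_exp_two_mul hu
  have h1 : ∀ i j k, pd i (fun q => kahlerForm (fun q => Real.exp (2 * u q) • g q) J q j k) p
      = Real.exp (2 * u p) * (2 * pd i u p) * kahlerForm g J p j k
        + Real.exp (2 * u p) * pd i (fun q => kahlerForm g J q j k) p := fun i j k => by
    simp only [kahlerForm_conformal]
    rw [pd_mul hx.1 (hw j k), hx.2]
  simp only [extD2, h1, wedge12]
  ring

/-- Wedging with a nondegenerate two-form is injective on covectors in dimension four. -/
theorem eq_zero_of_wedge12 {w B : Matrix (Fin 4) (Fin 4) ℝ} (hB : w * B = 1) (hBt : Bᵀ = -B)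
    {a : Fin 4 → ℝ} (h : ∀ i j k, wedge12 a w i j k = 0) : a = 0 := by
  funext i
  have hB1 : ∀ i j, ∑ k, w i k * B k j = if i = j then 1 else 0 := fun i j => by
    rw [← Matrix.mul_apply, hB, Matrix.one_apply]
  have hB2 : ∀ j k, B j k = -B k j := fun j k => congrFun (congrFun hBt k) j
  have h2 : ∑ j, ∑ k, a k * w i j * B k j = -∑ k, a k * ∑ j, w i j * B j k := by
    rw [Finset.sum_comm, ← Finset.sum_neg_distrib]
    refine Finset.sum_congr rfl fun k _ => ?_
    rw [Finset.mul_sum, ← Finset.sum_neg_distrib]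
    exact Finset.sum_congr rfl fun j _ => by rw [hB2 k j]; ring
  -- Contracting `a ∧ w` with the inverse of `w` gives `(4 - 1 - 1) aᵢ = 2 aᵢ`.
  have h1 : ∑ j, ∑ k, wedge12 a w i j k * B k j = a i * ∑ j, ∑ k, w j k * B k j
      - ∑ j, a j * ∑ k, w i k * B k j + ∑ j, ∑ k, a k * w i j * B k j := by
    simp only [Finset.mul_sum, ← Finset.sum_sub_distrib, ← Finset.sum_add_distrib]
    refine Finset.sum_congr rfl fun j _ => Finset.sum_congr rfl fun k _ => ?_
    rw [wedge12]
    ring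
  rw [h2] at h1
  simp only [h, hB1] at h1
  simp at h1
  simp only [Pi.zero_apply]
  linarith

/-! ## Non-degeneracy of the geometry -/

theorem leeForm_eq (h H : ℝ × ℝ → ℝ) :
    leeForm H = fun q i => -Real.tan (q 2 / 2) * coframe h H q 3 i := by
  ext q i
  simp [leeForm, coframe]

namespace Admissible

variable {U : Set (ℝ × ℝ)} {h H : ℝ × ℝ → ℝ} (hA : Admissible U h H) {p : Pt}
include hA

variable (hp : p ∈ dom U)
include hp

omit hA in
theorem hasGrad_neg_tan : HasGrad (fun q => -Real.tan (q 2 / 2))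
    (fun i => -(1 / Real.cos (p 2 / 2) ^ 2 * (1 / 2 * dcoord 2 i))) p :=
  ((hasGrad_half p).tan (cos_half_pos hp).ne').neg

/-- Here `|θ|² = tan²(z/2)` and `δθ = 1 - tan²(z/2)`, so the conformal scalar curvature is `κ = τ -
6`, with `τ` the scalar curvature. -/
theorem normSq_add_codiff :
    normSq (metric h H) (leeForm H) p + codiff (metric h H) (leeForm H) p = 1 := by
  have h1 := (cos_half_pos hp).ne'
  have h2 := (hA.h_pos _ hp.1).ne'
  have h3 := (sin_half_pos hp).ne'
  have h5 := Real.sin_sq_add_cos_sq (p 2 / 2)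
  rw [leeForm_eq h H, hA.isMovingFrame.normSq_smul hp,
    hA.isMovingFrame.codiff_smul hp (hasGrad_neg_tan hp)]
  simp only [Fin.sum_univ_four, dualFrame, connMat, mixF, phiF, tauF, betaF, starF, dcoord,
    Matrix.of_apply, Matrix.cons_val, Pi.single_apply, Fin.isValue, Fin.reduceEq, reduceIte]
  rw [sin_eq_half (p 2), cos_eq_half (p 2), Real.tan_eq_sin_div_cos]
  field_simp
  linear_combination -2 * Real.cos (p 2 / 2) * h5

theorem extD1_leeForm (j : Fin 4) :
    extD1 (leeForm H) p 3 j = Real.tan (p 2 / 2) * betaF H p j := by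
  have h3 := Real.sin_sq_add_cos_sq (p 2)
  have hd : ∀ k, HasGrad (fun q => theta4 H q k) (fun i => pd i (fun q => theta4 H q k) p) p :=
    fun k => ⟨((hA.contDiffOn_theta4 k).contDiffAt
      ((isOpen_dom hA.isOpen).mem_nhds hp)).differentiableAt (by simp), fun _ => rfl⟩
  have h4 : tauF H p 3 = 1 := by simp [tauF, starF, dcoord]
  have h5 : betaF H p 3 = 0 := by simp [betaF, dcoord]
  have h6 : alphaF H p 3 = 0 := by simp [alphaF, dcoord]
  have h7 : dcoord 2 3 = 0 := by simp [dcoord]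
  unfold leeForm
  rw [extD1_smul (hasGrad_neg_tan hp) hd, hA.extD1_theta4 hp]
  simp only [wedge, Matrix.of_apply, phiF, theta3_eq, theta4_eq, h4, h5, h6, h7]
  linear_combination (Real.tan (p 2 / 2) * betaF H p j) * h3

omit hp in
-- If `e^{2u} Ω` is closed, then `(du + θ) ∧ Ω = 0`; nondegeneracy of `Ω` forces `θ = -du`,
-- contradicting `dθ ≠ 0`.
theorem not_isLCK (hne : U.Nonempty) : ¬ IsLCK (dom U) (metric h H)
    (frameEnd (coframe h H) (dualFrame h H) frameHerm) := by
  intro hL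
  obtain ⟨q, hq⟩ := hne
  -- At `t = 0` the component `dθ(∂_t, ∂_x) = tan(z/2) H cos t` is nonzero; any `z` in the interval
  -- would serve.
  set p : Pt := ![q.1, q.2, Real.pi / 2, 0] with hpdef
  have hp : p ∈ dom U := ⟨by simpa [base, hpdef] using hq, by simp [hpdef, Real.pi_pos], by
    simp [hpdef, Real.pi_pos]⟩
  obtain ⟨V, hV, hpV, hVM, u, hu, hK⟩ := hL p hp
  have hf := hA.isMovingFrame
  have hlee : ∀ r ∈ V, ∀ i, pd i u r = -leeForm H r i := by
    intro r hr i
    have hrM := hVM hr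
    set w := kahlerForm (metric h H) (frameEnd (coframe h H) (dualFrame h H) frameHerm) r with hw
    have hw' : w = (coframe h H r)ᵀ * frameHermᵀ * coframe h H r := hf.kahlerForm_eq hrM
    -- An explicit skew inverse of the Kähler form, as `eq_zero_of_wedge12` requires.
    have hw1 : w * (dualFrame h H r * frameHerm * (dualFrame h H r)ᵀ) = 1 := by
      rw [hw', frameHerm_skew]
      calc (coframe h H r)ᵀ * -frameHerm * coframe h H r
            * (dualFrame h H r * frameHerm * (dualFrame h H r)ᵀ)
          = -((coframe h H r)ᵀ * (frameHerm * (coframe h H r * dualFrame h H r) * frameHerm)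
            * (dualFrame h H r)ᵀ) := by noncomm_ring
        _ = (dualFrame h H r * coframe h H r)ᵀ := by
          rw [hf.inv' hrM, Matrix.mul_one, frameHerm_sq, Matrix.transpose_mul]; noncomm_ring
        _ = 1 := by rw [hf.inv r hrM, Matrix.transpose_one]
    have hB : (dualFrame h H r * frameHerm * (dualFrame h H r)ᵀ)ᵀ
        = -(dualFrame h H r * frameHerm * (dualFrame h H r)ᵀ) := by
      rw [Matrix.transpose_mul, Matrix.transpose_mul, Matrix.transpose_transpose,
        frameHerm_skew]
      noncomm_ring
    have hd : DiffTens (kahlerForm (metric h H)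
        (frameEnd (coframe h H) (dualFrame h H) frameHerm)) r :=
      DiffTens.mul (DiffTens.transpose ((hf.smooth_frameEnd frameHerm).diffTens hf.isOpen hrM))
        (hf.smooth_metric.diffTens hf.isOpen hrM)
    have hud : DifferentiableAt ℝ u r :=
      (hu.contDiffAt (hV.mem_nhds hr)).differentiableAt (by simp)
    have := eq_zero_of_wedge12 hw1 hB (a := fun l => pd l u r + leeForm H r l) fun i j k => by
      have h1 := hK.closed r hr i j k
      rw [extD2_conformal hud hd, hA.isLeeForm r hrM, ← hw] at h1
      have h2 := (mul_eq_zero.mp h1).resolve_left (Real.exp_pos _).ne'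
      simp only [wedge12] at h2 ⊢
      linarith
    have := congrFun this i
    simp only [Pi.zero_apply] at this
    linarith
  have hd : ∀ i j, extD1 (leeForm H) p i j = 0 := fun i j => by
    have h1 : ∀ i j, pd i (fun r => leeForm H r j) p = -pd i (pd j u) p := fun i j => by
      have hs : DifferentiableAt ℝ (pd j u) p :=
        ((contDiffOn_pd hV hu j).contDiffAt (hV.mem_nhds hpV)).differentiableAt (by simp)
      rw [pd_congr hV hpV (g := fun r => -pd j u r) (fun r hr => by rw [hlee r hr]; ring)]
      exact (HasGrad.neg ⟨hs, fun _ => rfl⟩).2 i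
    rw [extD1, h1, h1, pd_comm hV hu hpV]
    ring
  have h0 := hd 3 0
  rw [hA.extD1_leeForm hp] at h0
  have h1 := Real.tan_pos_of_pos_of_lt_pi_div_two (x := p 2 / 2) (by linarith [hp.2.1])
    (by linarith [hp.2.2])
  have h2 := hA.H_pos _ hp.1
  have h3 : p 3 = 0 := by simp [hpdef]
  simp [betaF, dcoord, h3] at h0
  rcases h0 with h0 | h0 <;> linarith

/-! ### Holomorphic curvature and the QCH property -/

omit hp in
theorem vertical_eq (X : Pt) (hp : p ∈ dom U) :
    X ∈ vertical p ↔ (coframe h H p *ᵥ X) 0 = 0 ∧ (coframe h H p *ᵥ X) 1 = 0 := by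
  have h1 := (cos_half_pos hp).ne'
  have h2 := (hA.h_pos _ hp.1).ne'
  have h3 : (coframe h H p *ᵥ X) 0 = Real.cos (p 2 / 2) * h (base p) * X 0 := by
    simp [coframe, Matrix.mulVec, dotProduct, Fin.sum_univ_four, dcoord]
  have h4 : (coframe h H p *ᵥ X) 1 = Real.cos (p 2 / 2) * h (base p) * X 1 := by
    simp [coframe, Matrix.mulVec, dotProduct, Fin.sum_univ_four, dcoord]
  rw [h3, h4, vertical, Submodule.mem_span_pair]
  constructor
  · rintro ⟨a, b, rfl⟩
    simp
  · rintro ⟨h5, h6⟩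
    have h5 : X 0 = 0 := by simpa [h1, h2] using h5
    have h6 : X 1 = 0 := by simpa [h1, h2] using h6
    refine ⟨X 2, X 3, ?_⟩
    ext i
    fin_cases i <;> simp [h5, h6]

theorem perp_vertical {X : Pt} (hX : Perp (metric h H p) (vertical p) X) :
    (coframe h H p *ᵥ X) 2 = 0 ∧ (coframe h H p *ᵥ X) 3 = 0 := by
  have hf := hA.isMovingFrame
  have key : ∀ k : Fin 4, k ≠ 0 → k ≠ 1 → (coframe h H p *ᵥ X) k = 0 := fun k h0 h1 => by
    have := hX (dualFrame h H p *ᵥ Pi.single k 1) (by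
      rw [hA.vertical_eq _ hp, hf.mulVec_dual hp]
      simp [h0.symm, h1.symm])
    rw [hf.ev2_eq hp, hf.mulVec_dual hp] at this
    simpa using this
  exact ⟨key 2 (by decide) (by decide), key 3 (by decide) (by decide)⟩

theorem holCurv_eq (X : Pt) :
    holCurv (metric h H) (frameEnd (coframe h H) (dualFrame h H) frameKahler) p X
      = ev2 (metric h H p) X X ^ 2 + (baseCurv h H p - 1)
        * ((coframe h H p *ᵥ X) 0 ^ 2 + (coframe h H p *ᵥ X) 1 ^ 2) ^ 2 := by
  rw [holCurv, hA.curv4_frame hp, hA.isMovingFrame.mulVec_frameEnd hp, modelCurv_holomorphic,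
    hA.isMovingFrame.ev2_eq hp]

omit hA hp in
theorem isPlaneField_vertical (hU : IsOpen U) : IsPlaneField (dom U) vertical := by
  intro p hp
  refine ⟨dom U, isOpen_dom hU, hp, subset_rfl, fun _ => Pi.single 2 1, fun _ => Pi.single 3 1,
    contDiffOn_const, contDiffOn_const, fun q _ => ⟨?_, rfl⟩⟩
  rw [LinearIndependent.pair_iff]
  intro s t hst
  exact ⟨by simpa using congrFun hst 2, by simpa using congrFun hst 3⟩

omit hp in
theorem isQCH : IsQCH (dom U) (metric h H)
    (frameEnd (coframe h H) (dualFrame h H) frameKahler) vertical where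
  kahler := hA.isKahler
  planeField := isPlaneField_vertical hA.isOpen
  invariant p hp X hX := by
    rw [hA.vertical_eq _ hp] at hX ⊢
    rw [hA.isMovingFrame.mulVec_frameEnd hp, frameKahler_mulVec]
    simp [hX.1, hX.2]
  quasiConst p hp A hAv A' hA' B B' hB hB' h1 h1' hAA := by
    -- `A` has no base components and `B` no fibre components, so the base part of the unit vector
    -- `A + B` has squared length `1 - |A|²`.
    have key : ∀ A ∈ vertical p, ∀ B, Perp (metric h H p) (vertical p) B →
        ev2 (metric h H p) (A + B) (A + B) = 1 →
        (coframe h H p *ᵥ (A + B)) 0 ^ 2 + (coframe h H p *ᵥ (A + B)) 1 ^ 2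
          = 1 - ev2 (metric h H p) A A := fun A hAv B hB h1 => by
      rw [hA.vertical_eq _ hp] at hAv
      have hB := hA.perp_vertical hp hB
      rw [hA.isMovingFrame.ev2_eq hp, Matrix.mulVec_add] at h1
      rw [hA.isMovingFrame.ev2_eq hp, Matrix.mulVec_add]
      simp only [dotProduct, Fin.sum_univ_four, Pi.add_apply, hAv.1, hAv.2, hB.1, hB.2] at h1 ⊢
      linarith
    rw [hA.holCurv_eq hp, hA.holCurv_eq hp, h1, h1', key A hAv B hB h1, key A' hA' B' hB' h1',
      hAA]

omit hp in
theorem isNaturalOpposite : IsNaturalOpposite (dom U) (metric h H)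
    (frameEnd (coframe h H) (dualFrame h H) frameHerm)
    (frameEnd (coframe h H) (dualFrame h H) frameKahler) vertical := by
  intro p hp
  have hf := hA.isMovingFrame
  refine ⟨fun X hX => hf.mulVec_injective hp ?_, fun X hX => hf.mulVec_injective hp ?_⟩
  · rw [hA.vertical_eq _ hp] at hX
    rw [Matrix.mulVec_neg, hf.mulVec_frameEnd hp, hf.mulVec_frameEnd hp, frameHerm_mulVec,
      frameKahler_mulVec]
    ext a
    fin_cases a <;> simp [hX.1, hX.2]
  · have hX := hA.perp_vertical hp hX
    rw [hf.mulVec_frameEnd hp, hf.mulVec_frameEnd hp, frameHerm_mulVec, frameKahler_mulVec]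
    ext a
    fin_cases a <;> simp [hX.1, hX.2]

/-! ### Failure of semi-symmetry -/

theorem not_grayG1At : ¬ GrayG1At (metric h H)
    (frameEnd (coframe h H) (dualFrame h H) frameHerm) p := by
  intro hG
  have hf := hA.isMovingFrame
  -- Since `J e₃ = -e₂` and `J e₀ = e₁`, the condition would equate `R(-e₂,e₁,e₀,e₃) = -1/4` with
  -- `R(e₃,e₀,e₀,e₃) = 1/4`; neither involves `A`.
  have := hG (dualFrame h H p *ᵥ Pi.single 3 1) (dualFrame h H p *ᵥ Pi.single 0 1)
    (dualFrame h H p *ᵥ Pi.single 0 1) (dualFrame h H p *ᵥ Pi.single 3 1)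
  rw [hA.curv4_frame hp, hA.curv4_frame hp, hf.mulVec_frameEnd hp, hf.mulVec_frameEnd hp] at this
  simp only [hf.mulVec_dual hp, modelCurv_mulVec _ _ _ _ rfl rfl rfl rfl, frameHerm_mulVec] at this
  simp [wedge, dotProduct, Fin.sum_univ_four] at this
  norm_num at this

theorem scal_ne_confScal :
    scal (metric h H) p ≠ confScal (metric h H) (leeForm H) p := by
  rw [confScal, hA.normSq_add_codiff hp]
  intro h
  linarith

theorem constHolCurvAt_of_derivedCurvZeroAt (hR : DerivedCurvZeroAt (metric h H) p) :
    ConstHolCurvAt (metric h H)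
      (frameEnd (coframe h H) (dualFrame h H) frameKahler) p := by
  have hf := hA.isMovingFrame
  -- The `e₂` component of `(R(e₃,e₀)·R)(e₀,e₁)e₀` is `(1 - A)/4`, so its vanishing forces `A = 1`,
  -- where the correction to the space form curvature disappears.
  have h1 := congrArg (coframe h H p *ᵥ ·) (hR (dualFrame h H p *ᵥ Pi.single 3 1)
    (dualFrame h H p *ᵥ Pi.single 0 1) (dualFrame h H p *ᵥ Pi.single 0 1)
    (dualFrame h H p *ᵥ Pi.single 1 1) (dualFrame h H p *ᵥ Pi.single 0 1))
  simp only [Matrix.mulVec_sub, Matrix.mulVec_zero, hA.curv_frame hp, hf.mulVec_dual hp] at h1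
  have h2 := congrFun h1 2
  simp only [modelCurv_mulVec _ _ _ _ rfl rfl rfl rfl, Pi.sub_apply, Pi.zero_apply] at h2
  simp [wedge] at h2
  have h3 : baseCurv h H p = 1 := by linarith
  refine ⟨1, fun X hX => ?_⟩
  rw [hA.holCurv_eq hp, h3, hX]
  ring

end Admissible

end KSurf

end

theorem theorem2 (U : Set (ℝ × ℝ)) (hU : IsOpen U) (hUne : U.Nonempty)
    (h H : ℝ × ℝ → ℝ) (h_smooth : ContDiffOn ℝ ∞ h U) (H_smooth : ContDiffOn ℝ ∞ H U)
    (h_pos : ∀ q ∈ U, 0 < h q) (H_pos : ∀ q ∈ U, 0 < H q)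
    (h_eq : ∀ q ∈ U, KSurf.lap (KSurf.logF H) q = (1 / 2) * h q ^ 2 - H q ^ 2) :
    KSurf.IsRiemannian (KSurf.dom U) (KSurf.metric h H) ∧
    ∃ Jbar J : KSurf.Tens,
      -- the Kähler structure with its Kähler form
      KSurf.IsKahler (KSurf.dom U) (KSurf.metric h H) Jbar ∧
      (∀ p ∈ KSurf.dom U, KSurf.kahlerForm (KSurf.metric h H) Jbar p
        = KSurf.baseForm h p + KSurf.wedge (KSurf.theta4 H p) (KSurf.theta3 H p)) ∧
      -- the opposite Hermitian structure with its Kähler form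
      KSurf.IsHermitian (KSurf.dom U) (KSurf.metric h H) J ∧
      (∀ p ∈ KSurf.dom U, KSurf.kahlerForm (KSurf.metric h H) J p
        = KSurf.baseForm h p + KSurf.wedge (KSurf.theta3 H p) (KSurf.theta4 H p)) ∧
      KSurf.AreOpposite (KSurf.dom U) (KSurf.metric h H) J Jbar ∧
      -- Ricci tensor, Lee form, not locally conformally Kähler
      KSurf.RicciInvariant (KSurf.dom U) (KSurf.metric h H) J ∧
      KSurf.IsLeeForm (KSurf.dom U) (KSurf.metric h H) J (KSurf.leeForm H) ∧
      ¬ KSurf.IsLCK (KSurf.dom U) (KSurf.metric h H) J ∧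
      -- QCH, with `J` as natural opposite structure
      KSurf.IsQCH (KSurf.dom U) (KSurf.metric h H) Jbar KSurf.vertical ∧
      KSurf.IsNaturalOpposite (KSurf.dom U) (KSurf.metric h H) J Jbar KSurf.vertical ∧
      -- not semi-symmetric, at any point
      (∀ p ∈ KSurf.dom U, ¬ KSurf.GrayG1At (KSurf.metric h H) J p) ∧
      (∀ p ∈ KSurf.dom U, KSurf.scal (KSurf.metric h H) p
        ≠ KSurf.confScal (KSurf.metric h H) (KSurf.leeForm H) p) ∧
      (∀ p ∈ KSurf.dom U, KSurf.DerivedCurvZeroAt (KSurf.metric h H) p →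
        KSurf.ConstHolCurvAt (KSurf.metric h H) Jbar p) := by
  have hA : KSurf.Admissible U h H := ⟨hU, h_smooth, H_smooth, h_pos, H_pos, h_eq⟩
  exact ⟨hA.isMovingFrame.isRiemannian,
    KSurf.frameEnd (KSurf.coframe h H) (KSurf.dualFrame h H) KSurf.frameKahler,
    KSurf.frameEnd (KSurf.coframe h H) (KSurf.dualFrame h H) KSurf.frameHerm,
    hA.isKahler, fun _ hp => hA.kahlerForm_frameKahler hp, hA.isHermitian,
    fun _ hp => hA.kahlerForm_frameHerm hp, hA.areOpposite, hA.ricciInvariant, hA.isLeeForm,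
    hA.not_isLCK hUne, hA.isQCH, hA.isNaturalOpposite, fun _ hp => hA.not_grayG1At hp,
    fun _ hp => hA.scal_ne_confScal hp,
    fun _ hp hR => hA.constHolCurvAt_of_derivedCurvZeroAt hp hR⟩
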